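/- Throughout, a hypergraph $G=(V,E,i)$ consists of finite sets $V=V(G)$ (vertices) and $E=E(G)$ (edges) and a map $i=i_G:E\to 2^V$ with $|i(e)|\ge 2$ for all $e\in E$ (parallel edges are allowed); the degree $d_G(v)$ is the number of edges $e$ with $v\in i_G(e)$. For $S\subseteq V(G)$, $G[S]$ is the subhypergraph with vertex set $S$ and edge set $\{e\in E(G): i_G(e)\subseteq S\}$, and $S$ is independent if $G[S]$ has no edge. A matching of $G$ is a set of edges such that every vertex lies in at most one of them. $G$ is connected if any two vertices $x,y$ are joined by a hyperpath, i.e. there are $q\ge 0$, distinct vertices $x=v_1,\dots,v_{q+1}=y$ and distinct edges $e_1,\dots,e_q$ with $\{v_j,v_{j+1}\}\subseteq i_G(e_j)$ for all $j$. A vertex $v$ is separating if $G$ is the union of two induced subhypergraphs, each with at least two vertices, whose vertex sets intersect exactly in $\{v\}$. A block of $G$ is a maximal connected subhypergraph of $G$ that has no separating vertex (of its own). A cover of $G$ is a pair $(X,H)$, where $H$ is a hypergraph and $X$ assigns to each $v\in V(G)$ a (possibly empty) set $X_v\subseteq V(H)$, such that the sets $X_v$ are pairwise disjoint, independent in $H$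 and have union $V(H)$, and such that $E(H)=\bigcup_{e\in E(G)}M_e$, where for each $e\in E(G)$ the set $M_e$ is a (possibly empty) matching of $H[\bigcup_{v\in i_G(e)}X_v]$ with $|i_H(\tilde e)\cap X_v|=1$ for all $\tilde e\in M_e$ and $v\in i_G(e)$. $G$ is DP-degree colorable if for every cover $(X,H)$ of $G$ with $|X_v|\ge d_G(v)$ for all $v\in V(G)$ there is an independent set $T$ of $H$ with $|T\cap X_v|=1$ for all $v\in V(G)$. For a simple graph $S$ and $t\ge 1$, $tS$ denotes the hypergraph obtained from $S$ by replacing each edge by $t$ parallel edges. A DP-hyperbrick is a hypergraph that is isomorphic to $tK_n$ for some $t,n\ge 1$, or to $tC_n$ for some $t\ge 1$, $n\ge 3$ (where $K_n$ and $C_n$ are the complete graph and the cycle on $n$ vertices), or that has exactly one edge $e$ and satisfies $i(e)=V$. **Theorem.** A connected hypergraph $G$ is not DP-degree colorable if and only if every block of $G$ is a DP-hyperbrick. -/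

import Mathlib

universe u v u' v' w

/-- A hypergraph with vertex set `V`, edge set `E` and incidence function `inc`; parallel edges are
allowed, and every edge is incident to at least two vertices. Hypergraphs are meant to be
finite: finiteness of `V` and `E` is an instance hypothesis where it matters. -/
structure MultiHypergraph (V : Type u) (E : Type v) where
  inc : E → Set V
  inc_nontrivial : ∀ e, (inc e).Nontrivial

namespace MultiHypergraph

section Basic

variable {V : Type u} {E : Type v}

/-- The degree of `x`: the number of edges incident to `x`. -/
noncomputable def degree (G : MultiHypergraph V E) (x : V) : ℕ :=
  {e : E | x ∈ G.inc e}.ncard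

/-- There is a hyperpath from `x` to `y`: distinct vertices `p 0 = x, …, p q = y` and distinct edges
`f 0, …, f (q - 1)` such that `f i` is incident to both `p i` and `p (i + 1)`. -/
def HasHyperpath (G : MultiHypergraph V E) (x y : V) : Prop :=
  ∃ (q : ℕ) (p : Fin (q + 1) → V) (f : Fin q → E),
    Function.Injective p ∧ Function.Injective f ∧ p 0 = x ∧ p (Fin.last q) = y ∧
      ∀ i : Fin q, p i.castSucc ∈ G.inc (f i) ∧ p i.succ ∈ G.inc (f i)

/-- Any two vertices are joined by a hyperpath. -/
def IsConnected (G : MultiHypergraph V E) : Prop :=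
  ∀ x y : V, G.HasHyperpath x y

/-- A subhypergraph: a set of vertices and a set of edges that contains with each edge all its
incident vertices; the incidence function is inherited. -/
structure Sub (G : MultiHypergraph V E) where
  verts : Set V
  edges : Set E
  inc_subset : ∀ e ∈ edges, G.inc e ⊆ verts

instance (G : MultiHypergraph V E) : LE G.Sub where
  le A B := A.verts ⊆ B.verts ∧ A.edges ⊆ B.edges

/-- A subhypergraph as a hypergraph of its own. -/
def Sub.coe {G : MultiHypergraph V E} (B : G.Sub) : MultiHypergraph B.verts B.edges where
  inc e := {x | (x : V) ∈ G.inc e}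
  inc_nontrivial e := by
    obtain ⟨x, hx, y, hy, hxy⟩ := G.inc_nontrivial e
    exact ⟨⟨x, B.inc_subset e e.2 hx⟩, hx, ⟨y, B.inc_subset e e.2 hy⟩, hy,
      fun h => hxy (congrArg Subtype.val h)⟩

/-- The subhypergraph induced by a set `S` of vertices. -/
def induce (G : MultiHypergraph V E) (S : Set V) : G.Sub where
  verts := S
  edges := {e | G.inc e ⊆ S}
  inc_subset _ he := he

/-- A set of vertices is independent if the subhypergraph that it induces has no edge. -/
def IsIndependent (G : MultiHypergraph V E) (S : Set V) : Prop :=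
  (G.induce S).edges = ∅

/-- `x` is a separating vertex: the hypergraph is the union of two induced subhypergraphs, each with
at least two vertices, that have exactly the vertex `x` in common. -/
def IsSeparating (G : MultiHypergraph V E) (x : V) : Prop :=
  ∃ S T : Set V, S ∩ T = {x} ∧ S.Nontrivial ∧ T.Nontrivial ∧
    (G.induce S).verts ∪ (G.induce T).verts = Set.univ ∧
    (G.induce S).edges ∪ (G.induce T).edges = Set.univ

/-- A block of `G`: a maximal connected subhypergraph of `G` that has no separating vertex. -/
def IsBlock (G : MultiHypergraph V E) (B : G.Sub) : Prop :=
  Maximal (fun C : G.Sub => C.coe.IsConnected ∧ ∀ x, ¬ C.coe.IsSeparating x) B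

/-- A set of edges is a matching if every vertex lies in at most one of them. -/
def IsMatching (G : MultiHypergraph V E) (M : Set E) : Prop :=
  ∀ x : V, ∀ e ∈ M, ∀ f ∈ M, x ∈ G.inc e → x ∈ G.inc f → e = f

/-- An isomorphism of hypergraphs. -/
structure Iso {V' : Type u'} {E' : Type v'} (G : MultiHypergraph V E)
    (G' : MultiHypergraph V' E') where
  vertEquiv : V ≃ V'
  edgeEquiv : E ≃ E'
  inc_edgeEquiv : ∀ e, G'.inc (edgeEquiv e) = vertEquiv '' G.inc e

/-- `t`-fold multiple `tS` of a simple graph `S`: every edge is replaced by `t` parallel edges. -/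
def multiple (t : ℕ) (S : SimpleGraph V) : MultiHypergraph V (S.edgeSet × Fin t) where
  inc e := {x | x ∈ (e.1 : Sym2 V)}
  inc_nontrivial := by
    rintro ⟨⟨e, he⟩, i⟩
    induction e with
    | h x y => exact ⟨x, Sym2.mem_mk_left x y, y, Sym2.mem_mk_right x y, S.ne_of_adj he⟩

/-- `G` is (a copy of) `tK_n` for some `t, n ≥ 1`, or of `tC_n` for some `t ≥ 1` and `n ≥ 3`. -/
def IsDPBrick (G : MultiHypergraph V E) : Prop :=
  (∃ t n : ℕ, 1 ≤ t ∧ 1 ≤ n ∧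
    Nonempty (G.Iso (multiple t (SimpleGraph.completeGraph (Fin n))))) ∨
  (∃ t n : ℕ, 1 ≤ t ∧ 3 ≤ n ∧
    Nonempty (G.Iso (multiple t (SimpleGraph.cycleGraph n))))

/-- `G = <e>`: the edge `e` is the only edge, and it is incident to all vertices. -/
def IsSingleEdge (G : MultiHypergraph V E) (e : E) : Prop :=
  G.inc e = Set.univ ∧ ∀ f : E, f = e

/-- A DP-hyperbrick: a DP-brick, or a hypergraph of the form `<e>` for some edge `e`. -/
def IsDPHyperbrick (G : MultiHypergraph V E) : Prop :=
  G.IsDPBrick ∨ ∃ e : E, G.IsSingleEdge e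

end Basic

section DPColoring

variable {V : Type u} {E : Type v} {W : Type u'} {F : Type v'}

/-- `(X, H)` is a cover of `G`: the sets `X x` partition the vertices (colors) of `H` into
independent sets (possibly empty), and the edge set of `H` is the union of matchings `M e`, one for
each edge `e` of `G`, where `M e` is a matching of the subhypergraph of `H` induced by the union of
the sets `X x` with `x` incident to `e`, all of whose edges meet each of these sets `X x` in exactly
one vertex. -/
structure IsCover (G : MultiHypergraph V E) (X : V → Set W) (H : MultiHypergraph W F) : Prop where
  disjoint : ∀ x y : V, x ≠ y → Disjoint (X x) (X y)
  iUnion_eq : ⋃ x, X x = Set.univ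
  independent : ∀ x, H.IsIndependent (X x)
  exists_matching : ∃ M : E → Set F,
    (∀ e, M e ⊆ (H.induce (⋃ x ∈ G.inc e, X x)).edges ∧ H.IsMatching (M e) ∧
      ∀ f ∈ M e, ∀ x ∈ G.inc e, (H.inc f ∩ X x).ncard = 1) ∧
    ⋃ e, M e = Set.univ

/-- `G` is `(X, H)`-colorable: there is an independent transversal of `(X, H)`. -/
def IsCoverColorable (X : V → Set W) (H : MultiHypergraph W F) : Prop :=
  ∃ T : Set W, (∀ x, (T ∩ X x).ncard = 1) ∧ H.IsIndependent T

/-- `G` is DP-degree colorable: it is `(X, H)`-colorable for every cover `(X, H)`, with `H` a finite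
hypergraph, such that `X x` has at least `degree x` elements for each vertex `x`. (As `H` is finite,
the universe that its vertices and edges are taken from is immaterial.) -/
def IsDPDegreeColorable (G : MultiHypergraph V E) : Prop :=
  ∀ (W F : Type w) [Finite W] [Finite F] (X : V → Set W) (H : MultiHypergraph W F),
    G.IsCover X H → (∀ x, G.degree x ≤ (X x).ncard) → IsCoverColorable X H

end DPColoring

end MultiHypergraph

namespace MultiHypergraph

open Set Function

/-! ### Forbidden colorings and greedy extension -/

section Greedy

variable {V : Type u} {E : Type v}

/-- The number of edges in `F` that are incident to `x`. -/
noncomputable def degOn (G : MultiHypergraph V E) (F : Set E) (x : V) : ℕ :=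
  {e | e ∈ F ∧ x ∈ G.inc e}.ncard

/-- The edges in `F` connect the vertices in `R` (traces of the edges on `R` are what counts). -/
def ConnOn (G : MultiHypergraph V E) (R : Set V) (F : Set E) : Prop :=
  ∀ Q ⊆ R, Q.Nonempty → (R \ Q).Nonempty →
    ∃ e ∈ F, (G.inc e ∩ Q).Nonempty ∧ (G.inc e ∩ (R \ Q)).Nonempty

/-- Two forbidden colorings of an edge that agree at one of its vertices agree at all of them. -/
def IsMatched (G : MultiHypergraph V E) (M : E → Set (V → ℕ)) : Prop :=
  ∀ e, ∀ φ ∈ M e, ∀ ψ ∈ M e, ∀ x ∈ G.inc e, φ x = ψ x → EqOn φ ψ (G.inc e)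

/-- The coloring `c` restricts to a forbidden coloring of `e`. -/
def Violates (G : MultiHypergraph V E) (M : E → Set (V → ℕ)) (c : V → ℕ) (e : E) : Prop :=
  ∃ φ ∈ M e, EqOn c φ (G.inc e)

/-- No coloring of `R` from the lists `L` satisfies all the edges in `F`. -/
def Uncolorable (G : MultiHypergraph V E) (R : Set V) (F : Set E) (L : V → Finset ℕ)
    (M : E → Set (V → ℕ)) : Prop :=
  ∀ c : V → ℕ, (∀ x ∈ R, c x ∈ L x) → ∃ e ∈ F, G.Violates M c e

/-- There are lists, at least as large as the degrees, and forbidden colorings without a coloring. -/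
def IsBad (G : MultiHypergraph V E) (R : Set V) (F : Set E) : Prop :=
  ∃ (L : V → Finset ℕ) (M : E → Set (V → ℕ)), G.IsMatched M ∧
    (∀ x ∈ R, G.degOn F x ≤ (L x).card) ∧ G.Uncolorable R F L M

variable {G : MultiHypergraph V E} {M : E → Set (V → ℕ)}

lemma Violates.congr {c c' : V → ℕ} {e : E} (h : G.Violates M c e) (hc : EqOn c c' (G.inc e)) :
    G.Violates M c' e := by
  obtain ⟨φ, hφ, hcφ⟩ := h
  exact ⟨φ, hφ, hc.symm.trans hcφ⟩

/-- An edge at `x` forbids at most one color at `x` once its other vertices are colored. -/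
lemma Violates.unique (hM : G.IsMatched M) {c c' : V → ℕ} {e : E} {x y : V} (hx : x ∈ G.inc e)
    (hy : y ∈ G.inc e) (h : G.Violates M c e) (h' : G.Violates M c' e) (hxy : c y = c' y) :
    c x = c' x := by
  obtain ⟨φ, hφ, hc⟩ := h
  obtain ⟨ψ, hψ, hc'⟩ := h'
  rw [hc hx, hc' hx]
  exact hM e φ hφ ψ hψ y hy (by rw [← hc hy, ← hc' hy, hxy]) hx

lemma Violates.update_unique (hM : G.IsMatched M) {c : V → ℕ} {e : E} {x : V} {a b : ℕ}
    [DecidableEq V] (hx : x ∈ G.inc e)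
    (h : G.Violates M (update c x a) e) (h' : G.Violates M (update c x b) e) : a = b := by
  obtain ⟨y, hy, hyx⟩ := (G.inc_nontrivial e).exists_ne x
  have := h.unique hM hx hy h' (by simp [hyx])
  simpa using this

lemma degOn_mono [Finite E] {F F' : Set E} (h : F ⊆ F') (x : V) : G.degOn F x ≤ G.degOn F' x :=
  ncard_le_ncard (fun _ he => ⟨h he.1, he.2⟩) (toFinite _)

lemma degOn_lt [Finite E] {F F' : Set E} (h : F ⊆ F') {x : V} {e : E} (he : e ∈ F')
    (he' : e ∉ F) (hx : x ∈ G.inc e) : G.degOn F x < G.degOn F' x :=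
  ncard_lt_ncard ⟨fun _ hf => ⟨h hf.1, hf.2⟩, fun hs => he' (hs ⟨he, hx⟩).1⟩ (toFinite _)

/-- Each edge at `x` excludes at most one color, so sending an excluded color to an edge excluding
it is injective. `N` holds further colors to be avoided, excluded by edges outside `F`. -/
lemma exists_color [Finite E] [DecidableEq V] (hM : G.IsMatched M) (c : V → ℕ) (F : Set E) (x : V)
    (A N : Finset ℕ) (h : N.card + G.degOn F x < A.card) :
    ∃ a ∈ A, a ∉ N ∧ ∀ e ∈ F, x ∈ G.inc e → ¬ G.Violates M (update c x a) e := by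
  by_contra! hcon
  have h1 : ∀ a ∈ A \ N, ∃ e, (e ∈ F ∧ x ∈ G.inc e) ∧ G.Violates M (update c x a) e := by
    intro a ha
    rw [Finset.mem_sdiff] at ha
    obtain ⟨e, h1, h2, h3⟩ := hcon a ha.1 ha.2
    exact ⟨e, ⟨h1, h2⟩, h3⟩
  have : Nonempty E := by
    obtain ⟨a, ha⟩ := Finset.card_pos.1
      (lt_of_lt_of_le (by omega) (Finset.le_card_sdiff N A) : 0 < (A \ N).card)
    exact ⟨(h1 a ha).choose⟩
  choose! f hf hf' using h1
  have h2 : ((A \ N : Finset ℕ) : Set ℕ).ncard ≤ G.degOn F x :=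
    ncard_le_ncard_of_injOn f (fun a ha => hf a ha)
      (fun a ha b hb hab => (hf' a ha).update_unique hM (hf a ha).2 (hab ▸ hf' b hb)) (toFinite _)
  rw [ncard_coe_finset] at h2
  have := Finset.card_le_card_sdiff_add_card (s := A) (t := N)
  omega

/-- Greedy coloring: a coloring `c` of the complement of `R` extends to `R` if every component of
`R` has a vertex that can be colored whatever the colors of the other vertices in `R` are. -/
theorem exists_extension [Finite V] [Finite E] [DecidableEq V] (hM : G.IsMatched M) {R : Set V}
    {F : Set E} {L : V → Finset ℕ} (c : V → ℕ) (hdeg : ∀ x ∈ R, G.degOn F x ≤ (L x).card)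
    (hR : ∀ Q ⊆ R, Q.Nonempty →
      (∃ x ∈ Q, ∀ c' : V → ℕ, EqOn c' c Rᶜ →
        ∃ a ∈ L x, ∀ e ∈ F, x ∈ G.inc e → ¬ G.Violates M (update c' x a) e) ∨
      ∃ e ∈ F, (G.inc e ∩ Q).Nonempty ∧ (G.inc e ∩ (R \ Q)).Nonempty) :
    ∃ c' : V → ℕ, EqOn c' c Rᶜ ∧ (∀ x ∈ R, c' x ∈ L x) ∧
      ∀ e ∈ F, (G.inc e ∩ R).Nonempty → ¬ G.Violates M c' e := by
  -- The coloring order is built backwards: `Q` is good if it can safely be left to the end,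
  -- whatever was done before on the rest of `R`. A maximal good set turns out to be `R`.
  let good : Set V → Prop := fun Q => Q ⊆ R ∧ ∀ c₁ : V → ℕ, EqOn c₁ c Rᶜ →
    (∀ x ∈ R \ Q, c₁ x ∈ L x) →
    (∀ e ∈ F, (G.inc e ∩ R).Nonempty → G.inc e ∩ Q = ∅ → ¬ G.Violates M c₁ e) →
    ∃ c' : V → ℕ, EqOn c' c Rᶜ ∧ (∀ x ∈ R, c' x ∈ L x) ∧
      ∀ e ∈ F, (G.inc e ∩ R).Nonempty → ¬ G.Violates M c' e
  have hgood0 : good ∅ := by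
    refine ⟨empty_subset _, fun c₁ h1 h2 h3 => ⟨c₁, h1, by simpa using h2, fun e he hR => ?_⟩⟩
    exact h3 e he hR (by simp)
  obtain ⟨Q, hQ⟩ := (toFinite {Q | good Q}).exists_maximal ⟨∅, hgood0⟩
  have hstep : ∀ x ∈ R \ Q, ¬ ∀ c₁ : V → ℕ, EqOn c₁ c Rᶜ →
      ∃ a ∈ L x, ∀ e ∈ F, x ∈ G.inc e → G.inc e ∩ Q = ∅ → ¬ G.Violates M (update c₁ x a) e := by
    intro x hx hcol
    have hins : good (insert x Q) := by
      refine ⟨insert_subset hx.1 hQ.prop.1, fun c₁ h1 h2 h3 => ?_⟩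
      obtain ⟨a, haL, ha⟩ := hcol c₁ h1
      refine hQ.prop.2 (update c₁ x a) ?_ ?_ ?_
      · intro y hy
        have : y ≠ x := by rintro rfl; exact hy hx.1
        rw [update_of_ne this]; exact h1 hy
      · intro y hy
        by_cases hyx : y = x
        · subst hyx; simpa using haL
        · rw [update_of_ne hyx]
          exact h2 y ⟨hy.1, by simp [hyx, hy.2]⟩
      · intro e he heR heQ
        by_cases hxe : x ∈ G.inc e
        · exact ha e he hxe heQ
        · intro hv
          refine h3 e he heR ?_ (hv.congr fun y hy => ?_)
          · rw [← heQ]; ext y; simp only [mem_inter_iff, mem_insert_iff]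
            constructor
            · rintro ⟨h1, rfl | h2⟩
              · exact absurd h1 hxe
              · exact ⟨h1, h2⟩
            · exact fun h => ⟨h.1, Or.inr h.2⟩
          · rw [update_of_ne]; rintro rfl; exact hxe hy
    exact hx.2 (hQ.le_of_ge hins (subset_insert x Q) (mem_insert x Q))
  by_cases hQR : (R \ Q).Nonempty
  · exfalso
    rcases hR (R \ Q) sdiff_subset hQR with ⟨x, hx, hcol⟩ | ⟨e, heF, ⟨x, hxe, hx⟩, ⟨y, hye, hy⟩⟩
    · exact hstep x hx fun c₁ h1 => by
        obtain ⟨a, ha, h⟩ := hcol c₁ h1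
        exact ⟨a, ha, fun e he hxe _ => h e he hxe⟩
    · refine hstep x hx fun c₁ h1 => ?_
      have hyQ : y ∈ Q := by
        by_contra h; exact hy.2 ⟨hy.1, h⟩
      -- When `x` is colored just before `Q`, the edge `e` still has the uncolored vertex `y`, so it
      -- does not constrain `x` yet.
      have hlt : G.degOn {e | e ∈ F ∧ G.inc e ∩ Q = ∅} x < G.degOn F x :=
        degOn_lt (fun _ h => h.1) heF
          (fun h => (h.2 ▸ (⟨hye, hyQ⟩ : y ∈ G.inc e ∩ Q) : y ∈ (∅ : Set V))) hxe
      obtain ⟨a, ha, -, h⟩ := exists_color hM c₁ {e | e ∈ F ∧ G.inc e ∩ Q = ∅} x (L x) ∅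
        (by simpa using hlt.trans_le (hdeg x hx.1))
      exact ⟨a, ha, fun e he hxe heQ => h e ⟨he, heQ⟩ hxe⟩
  · have hRQ : R ⊆ Q := by
      rw [not_nonempty_iff_eq_empty, sdiff_eq_empty] at hQR; exact hQR
    refine hQ.prop.2 c (fun _ _ => rfl) (fun x hx => absurd (hRQ hx.1) hx.2) ?_
    rintro e _ ⟨x, hxe, hxR⟩ heQ
    have : x ∈ G.inc e ∩ Q := ⟨hxe, hRQ hxR⟩
    rw [heQ] at this; exact this.elim

/-- In a connected part, one vertex with more colors than its degree suffices. -/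
theorem ConnOn.card_le [Finite V] [Finite E] (hM : G.IsMatched M) {R : Set V}
    {F : Set E} {L : V → Finset ℕ} (hdeg : ∀ x ∈ R, G.degOn F x ≤ (L x).card)
    (hconn : G.ConnOn R F) (hF : ∀ e ∈ F, (G.inc e ∩ R).Nonempty)
    (hbad : G.Uncolorable R F L M) {x : V} (hx : x ∈ R) : (L x).card ≤ G.degOn F x := by
  classical
  by_contra! hlt
  obtain ⟨c', -, h1, h2⟩ := exists_extension hM (fun _ => 0) hdeg (fun Q hQR hQ => by
    by_cases hxQ : x ∈ Q
    · left
      refine ⟨x, hxQ, fun c' _ => ?_⟩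
      obtain ⟨a, ha, -, h⟩ := exists_color hM c' F x (L x) ∅ (by simpa using hlt)
      exact ⟨a, ha, h⟩
    · right
      exact hconn Q hQR hQ ⟨x, hx, hxQ⟩)
  obtain ⟨e, he, hv⟩ := hbad c' h1
  exact h2 e he (hF e he) hv

end Greedy

/-! ### Edges with at least three vertices -/

section Hyperedge

variable {V : Type u} {E : Type v} {G : MultiHypergraph V E} {M : E → Set (V → ℕ)}

/-- The vertices that can be reached from `A` outside of `D`. -/
def reach (G : MultiHypergraph V E) (D A : Set V) : Set V :=
  ⋂₀ {K | A ⊆ K ∧ ∀ g, (G.inc g ∩ K).Nonempty → G.inc g \ D ⊆ K}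

lemma subset_reach (D A : Set V) : A ⊆ G.reach D A :=
  fun _ hx _ hK => hK.1 hx

lemma reach_subset {D A : Set V} (h : A ⊆ Dᶜ) : G.reach D A ⊆ Dᶜ :=
  fun _ hx => hx _ ⟨h, fun _ _ _ hy => hy.2⟩

lemma sdiff_subset_reach {D A : Set V} {g : E} (h : (G.inc g ∩ G.reach D A).Nonempty) :
    G.inc g \ D ⊆ G.reach D A := by
  obtain ⟨x, hxg, hx⟩ := h
  exact fun y hy K hK => hK.2 g ⟨x, hxg, hx K hK⟩ hy

lemma exists_edge_reach {D A Q : Set V} (hQ : Q ⊆ G.reach D A) (hne : Q.Nonempty)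
    (hA : Disjoint Q A) :
    ∃ e, (G.inc e ∩ Q).Nonempty ∧ (G.inc e ∩ (G.reach D A \ Q)).Nonempty := by
  by_contra! hcon
  obtain ⟨x, hx⟩ := hne
  refine (hQ hx (G.reach D A \ Q) ⟨fun y hy => ⟨subset_reach D A hy, fun h =>
    hA.notMem_of_mem_left h hy⟩, ?_⟩).2 hx
  rintro g ⟨y, hyg, hy⟩ z hz
  refine ⟨sdiff_subset_reach ⟨y, hyg, hy.1⟩ hz, fun hzQ => ?_⟩
  have := hcon g ⟨z, hz.1, hzQ⟩
  exact (this ▸ (⟨hyg, hy⟩ : y ∈ G.inc g ∩ (G.reach D A \ Q)) : y ∈ (∅ : Set V))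

/-- If an edge `f` at `u` runs into the component of `e` for no choice of a second vertex of the
edge `e` that is deleted together with `u`, then `u` separates. -/
lemma exists_reach_inter (hsep : ∀ x, G.ConnOn {x}ᶜ univ) {e f : E} {u v w : V} (hu : u ∈ G.inc e)
    (hv : v ∈ G.inc e) (hw : w ∈ G.inc e) (huv : v ≠ u) (huw : w ≠ u) (hvw : v ≠ w)
    (huf : u ∈ G.inc f) (hv0 : G.inc f ∩ G.reach {u, v} (G.inc e \ {u, v}) = ∅) :
    (G.inc f ∩ G.reach {u, w} (G.inc e \ {u, w})).Nonempty := by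
  by_contra! hw0
  set Kv := G.reach {u, v} (G.inc e \ {u, v}) with hKv
  set Kw := G.reach {u, w} (G.inc e \ {u, w}) with hKw
  have hvK : v ∈ Kw := subset_reach _ _ ⟨hv, by simp [huv, hvw]⟩
  have hwK : w ∈ Kv := subset_reach _ _ ⟨hw, by simp [huw, hvw.symm]⟩
  obtain ⟨y, hyf, hyu⟩ := (G.inc_nontrivial f).exists_ne u
  have hmem : ∀ z, z ∈ ({u}ᶜ \ (Kv ∪ Kw) : Set V) ↔ z ≠ u ∧ z ∉ Kv ∧ z ∉ Kw := by
    intro z; simp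
  -- The vertices other than `u` outside both components include `y`. An edge leaving this set while
  -- avoiding `u` as an endpoint of the crossing would pull its outer endpoint into `Kv` or `Kw`, as
  -- `v ∈ Kw` and `w ∈ Kv`.
  obtain ⟨g, -, ⟨z, hzg, hz⟩, ⟨z', hzg', hz'⟩⟩ := hsep u ({u}ᶜ \ (Kv ∪ Kw)) sdiff_subset
    ⟨y, (hmem y).2 ⟨hyu, fun h => (hv0 ▸ (⟨hyf, h⟩ : y ∈ G.inc f ∩ Kv) : y ∈ (∅ : Set V)),
      fun h => (hw0 ▸ (⟨hyf, h⟩ : y ∈ G.inc f ∩ Kw) : y ∈ (∅ : Set V))⟩⟩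
    ⟨v, huv, fun h => ((hmem v).1 h).2.2 hvK⟩
  rw [hmem] at hz
  have hgv : G.inc g ∩ Kv = ∅ := by
    by_contra h
    replace h := nonempty_iff_ne_empty.2 h
    refine hz.2.1 (sdiff_subset_reach h ⟨hzg, ?_⟩)
    rintro (rfl | rfl)
    · exact hz.1 rfl
    · exact hz.2.2 hvK
  have hgw : G.inc g ∩ Kw = ∅ := by
    by_contra h
    replace h := nonempty_iff_ne_empty.2 h
    refine hz.2.2 (sdiff_subset_reach h ⟨hzg, ?_⟩)
    rintro (rfl | rfl)
    · exact hz.1 rfl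
    · exact hz.2.1 hwK
  refine hz'.2 ((hmem z').2 ⟨hz'.1, fun h => ?_, fun h => ?_⟩)
  · exact (hgv ▸ (⟨hzg', h⟩ : z' ∈ G.inc g ∩ Kv) : z' ∈ (∅ : Set V))
  · exact (hgw ▸ (⟨hzg', h⟩ : z' ∈ G.inc g ∩ Kw) : z' ∈ (∅ : Set V))

/-- Give `v` a fixed color `b`. Each color at `u` must fail either on the component `K` of the rest
of `e` in `G - {u, v}` or on the remainder. On `K` at most one color fails, since such a failure
must be able to violate `e`, where `b` determines the color at `u`. On the remainder at most as many
fail as there are edges at `u` missing `K`. If `f ≠ e`, both edges run into `K`, so these bounds sum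
to less than the degree of `u`. -/
lemma eq_of_mem_inc_of_reach [Finite V] [Finite E] (hsep : ∀ x, G.ConnOn {x}ᶜ univ)
    (hbad : G.IsBad univ univ) {e f : E} {u v : V} (hu : u ∈ G.inc e) (hv : v ∈ G.inc e)
    (huv : v ≠ u) (huf : u ∈ G.inc f)
    (hf : (G.inc f ∩ G.reach {u, v} (G.inc e \ {u, v})).Nonempty)
    (hev : (G.inc e \ {u, v}).Nonempty) : f = e := by
  classical
  by_contra hfe
  obtain ⟨L, M, hM, hdeg, hunc⟩ := hbad
  set K := G.reach {u, v} (G.inc e \ {u, v}) with hK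
  have hKD : K ⊆ {u, v}ᶜ := reach_subset fun x hx => hx.2
  have huK : u ∉ K := fun h => hKD h (by simp)
  have hvK : v ∉ K := fun h => hKD h (by simp)
  have heK : (G.inc e ∩ K).Nonempty := by
    obtain ⟨x, hx⟩ := hev
    exact ⟨x, hx.1, subset_reach _ _ hx⟩
  have hpos : 0 < G.degOn univ v := (ncard_pos (toFinite _)).2 ⟨e, mem_univ _, hv⟩
  obtain ⟨b, hb⟩ := Finset.card_pos.1 (hpos.trans_le (hdeg v (mem_univ _)))
  let c₀ : V → ℕ := fun _ => b
  -- the edges that do not run into `K`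
  set F : Set E := {g | G.inc g ∩ K = ∅} with hF
  have hgF : ∀ g, g ∉ F → (G.inc g ∩ K).Nonempty := fun g hg =>
    nonempty_iff_ne_empty.2 hg
  have heF : e ∉ F := fun h => heK.ne_empty h
  have hfF : f ∉ F := fun h => hf.ne_empty h
  -- colors at `u` that do not extend to `K`
  let BK : Finset ℕ := (L u).filter fun a => ¬ ∃ c : V → ℕ, c u = a ∧ c v = b ∧
    (∀ x ∈ K, c x ∈ L x) ∧ ∀ g ∉ F, ¬ G.Violates M c g
  let BC : Finset ℕ := (L u).filter fun a => ¬ ∃ c : V → ℕ, c u = a ∧ c v = b ∧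
    (∀ x ∉ K, x ≠ u → x ≠ v → c x ∈ L x) ∧ ∀ g ∈ F, ¬ G.Violates M c g
  have hcover : L u ⊆ BK ∪ BC := by
    intro a ha
    by_contra hcon
    simp only [Finset.mem_union, not_or, BK, BC, Finset.mem_filter, ha, true_and, not_not] at hcon
    obtain ⟨⟨c₁, h1u, h1v, h1L, h1F⟩, ⟨c₂, h2u, h2v, h2L, h2F⟩⟩ := hcon
    obtain ⟨g, -, hg⟩ := hunc (fun x => if x ∈ K then c₁ x else c₂ x) (by
      intro x _
      by_cases hx : x ∈ K
      · simpa [hx] using h1L x hx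
      · by_cases hxu : x = u
        · subst hxu; simpa [hx, h2u] using ha
        · by_cases hxv : x = v
          · subst hxv; simpa [hx, h2v] using hb
          · simpa [hx] using h2L x hx hxu hxv)
    by_cases hgF' : g ∈ F
    · refine h2F g hgF' (hg.congr fun x hx => ?_)
      have : x ∉ K := fun h => (hgF' ▸ (⟨hx, h⟩ : x ∈ G.inc g ∩ K) : x ∈ (∅ : Set V))
      simp [this]
    · refine h1F g hgF' (hg.congr fun x hx => ?_)
      by_cases hxK : x ∈ K
      · simp [hxK]
      · by_cases hxu : x = u
        · subst hxu; simp [huK, h1u, h2u]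
        · by_cases hxv : x = v
          · subst hxv; simp [hvK, h1v, h2v]
          · exact absurd (sdiff_subset_reach (hgF g hgF') ⟨hx, by simp [hxu, hxv]⟩) hxK
  have hBK : BK.card ≤ 1 := by
    have key : ∀ a ∈ BK, ∃ c : V → ℕ, c v = b ∧ c u = a ∧ G.Violates M c e := by
      intro a ha
      simp only [BK, Finset.mem_filter] at ha
      by_contra! hcon
      refine ha.2 ?_
      obtain ⟨c', h1, h2, h3⟩ := exists_extension (R := K) (F := Fᶜ) (L := L) hM (update c₀ u a)
        (fun x _ => (degOn_mono (subset_univ _) x).trans (hdeg x (mem_univ _))) (fun Q hQ hne => by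
          by_cases hQe : Disjoint Q (G.inc e \ {u, v})
          · right
            obtain ⟨g, hg1, hg2⟩ := exists_edge_reach hQ hne hQe
            exact ⟨g, fun h => (hg2.mono (inter_subset_inter_right _ sdiff_subset)).ne_empty h,
              hg1, hg2⟩
          · left
            obtain ⟨x, hxQ, hxe⟩ := not_disjoint_iff.1 hQe
            refine ⟨x, hxQ, fun c' hc' => ?_⟩
            -- With `a` at `u` and `b` at `v` the edge `e` is never violated (`hcon`), so every
            -- vertex of `e` in `K` gains a spare color.
            have hlt : G.degOn (Fᶜ \ {e}) x < G.degOn univ x :=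
              degOn_lt (subset_univ _) (mem_univ e) (by simp) hxe.1
            obtain ⟨d, hd, -, h⟩ := exists_color hM c' (Fᶜ \ {e}) x (L x) ∅
              (by simpa using hlt.trans_le (hdeg x (mem_univ _)))
            have hxu : x ≠ u := fun h => hxe.2 (by simp [h])
            have hxv : x ≠ v := fun h => hxe.2 (by simp [h])
            refine ⟨d, hd, fun g hg hxg => ?_⟩
            by_cases hge : g = e
            · subst hge
              refine hcon _ ?_ ?_
              · rw [update_of_ne hxv.symm, hc' hvK, update_of_ne huv]
              · rw [update_of_ne hxu.symm, hc' huK, update_self]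
            · exact h g ⟨hg, hge⟩ hxg)
      refine ⟨c', ?_, ?_, h2, fun g hg => h3 g hg (hgF g hg)⟩
      · rw [h1 huK, update_self]
      · rw [h1 hvK, update_of_ne huv]
    refine Finset.card_le_one.2 fun a ha a' ha' => ?_
    obtain ⟨c, hc1, hc2, hc3⟩ := key a ha
    obtain ⟨c', hc1', hc2', hc3'⟩ := key a' ha'
    rw [← hc2, ← hc2']
    exact hc3.unique hM hu hv hc3' (hc1.trans hc1'.symm)
  have hBC : BC.card ≤ G.degOn F u := by
    by_contra! hlt
    have hvR : v ∉ (K ∪ {v})ᶜ := by simp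
    obtain ⟨c', h1, h2, h3⟩ := exists_extension (R := (K ∪ {v})ᶜ) (F := F)
      (L := update L u BC) hM c₀
      (fun x _ => by
        by_cases hx : x = u
        · subst hx; simpa using hlt.le
        · simpa [hx] using (degOn_mono (subset_univ _) x).trans (hdeg x (mem_univ _)))
      (fun Q hQ hne => by
        by_cases huQ : u ∈ Q
        · left
          refine ⟨u, huQ, fun c' _ => ?_⟩
          obtain ⟨d, hd, -, h⟩ := exists_color hM c' F u BC ∅ (by simpa using hlt)
          exact ⟨d, by simpa using hd, h⟩
        · right
          obtain ⟨g, -, ⟨x, hxg, hx⟩, ⟨y, hyg, hy⟩⟩ := hsep v Q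
            (fun x hx => by have := hQ hx; simp at this; simpa using this.1) hne
            ⟨u, by simpa using huv.symm, huQ⟩
          have hxK := hQ hx
          simp only [mem_compl_iff, mem_union, mem_singleton_iff, not_or] at hxK
          -- An edge meeting `K` would put `x`, which is neither `u` nor `v`, into `K`.
          have hgF' : g ∈ F := by
            by_contra h
            refine hxK.1 (sdiff_subset_reach (hgF g h) ⟨hxg, ?_⟩)
            rintro (rfl | rfl)
            · exact huQ hx
            · exact hxK.2 rfl
          refine ⟨g, hgF', ⟨x, hxg, hx⟩, y, hyg, ?_, hy.2⟩
          simp only [mem_compl_iff, mem_union, mem_singleton_iff, not_or]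
          exact ⟨fun h => (hgF' ▸ (⟨hyg, h⟩ : y ∈ G.inc g ∩ K) : y ∈ (∅ : Set V)), hy.1⟩)
    have hu' : c' u ∈ BC := by
      have := h2 u (by simp [huK, huv.symm])
      simpa using this
    simp only [BC, Finset.mem_filter] at hu'
    refine hu'.2 ⟨c', rfl, h1 hvR, fun x hxK hxu hxv => ?_, fun g hg => h3 g hg ?_⟩
    · simpa [hxu] using h2 x (by simp [hxK, hxv])
    · obtain ⟨y, hyg, hyv⟩ := (G.inc_nontrivial g).exists_ne v
      refine ⟨y, hyg, ?_⟩
      simp only [mem_compl_iff, mem_union, mem_singleton_iff, not_or]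
      exact ⟨fun h => (hg ▸ (⟨hyg, h⟩ : y ∈ G.inc g ∩ K) : y ∈ (∅ : Set V)), hyv⟩
  have h1 : G.degOn F u < G.degOn (insert f F) u :=
    degOn_lt (subset_insert _ _) (mem_insert f F) hfF huf
  have h2 : G.degOn (insert f F) u < G.degOn univ u :=
    degOn_lt (subset_univ _) (mem_univ e) (by simp [Ne.symm hfe, heF]) hu
  have h3 := hdeg u (mem_univ _)
  have h4 := (Finset.card_le_card hcover).trans (Finset.card_union_le BK BC)
  omega

/-- A connected hypergraph without separating vertex that has a bad cover and an edge with at least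
three vertices has no other edge. -/
theorem isSingleEdge_of_isBad [Finite V] [Finite E] (hconn : G.ConnOn univ univ)
    (hsep : ∀ x, G.ConnOn {x}ᶜ univ) (hbad : G.IsBad univ univ) {e : E}
    (he : 2 < (G.inc e).ncard) : G.IsSingleEdge e := by
  have key : ∀ u ∈ G.inc e, ∀ f, u ∈ G.inc f → f = e := by
    intro u hu f hf
    obtain ⟨v, hv, huv⟩ := (G.inc_nontrivial e).exists_ne u
    have hpair : ∀ v, (G.inc e \ {u, v}).Nonempty := by
      intro v
      by_contra! h
      rw [sdiff_eq_empty] at h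
      have := (ncard_le_ncard h (toFinite _)).trans (ncard_insert_le u {v})
      rw [ncard_singleton] at this
      omega
    obtain ⟨w, hw, hwu⟩ := hpair v
    simp only [mem_insert_iff, mem_singleton_iff, not_or] at hwu
    by_cases hv0 : (G.inc f ∩ G.reach {u, v} (G.inc e \ {u, v})).Nonempty
    · exact eq_of_mem_inc_of_reach hsep hbad hu hv huv hf hv0 (hpair v)
    · exact eq_of_mem_inc_of_reach hsep hbad hu hw hwu.1 hf
        (exists_reach_inter hsep hu hv hw huv hwu.1 (Ne.symm hwu.2) hf
          (not_nonempty_iff_eq_empty.1 hv0)) (hpair w)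
  have huniv : G.inc e = univ := by
    by_contra h
    obtain ⟨g, -, ⟨x, hxg, hx⟩, ⟨y, hyg, hy⟩⟩ := hconn (G.inc e) (subset_univ _)
      (G.inc_nontrivial e).nonempty (by
        rw [← compl_eq_univ_sdiff]; exact nonempty_compl.2 h)
    exact hy.2 (key x hx g hxg ▸ hyg)
  refine ⟨huniv, fun f => ?_⟩
  obtain ⟨x, hx⟩ := (G.inc_nontrivial f).nonempty
  exact key x (huniv ▸ mem_univ x) f hx

end Hyperedge

/-! ### Rigidity when all edges have two vertices -/

section Multigraph

variable {V : Type u} {E : Type v} {G : MultiHypergraph V E} {M : E → Set (V → ℕ)}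
  {L : V → Finset ℕ} {F : Set E} {R : Set V}

/-- The number of edges in `F` between `x` and `y`. -/
noncomputable def mult (G : MultiHypergraph V E) (F : Set E) (x y : V) : ℕ :=
  {e | e ∈ F ∧ G.inc e = {x, y}}.ncard

open Classical in
/-- The colors that the edges between `x` and `y` forbid at `y` if `x` has the color `a`. -/
noncomputable def forbidden (G : MultiHypergraph V E) (L : V → Finset ℕ) (M : E → Set (V → ℕ))
    (x y : V) (a : ℕ) : Finset ℕ :=
  (L y).filter fun b => ∃ e, G.inc e = {x, y} ∧ ∃ φ ∈ M e, φ x = a ∧ φ y = b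

lemma mult_comm (x y : V) : G.mult F x y = G.mult F y x := by
  simp only [mult, pair_comm]

lemma mult_pos [Finite E] {e : E} {x y : V} (h : G.inc e = {x, y}) : 0 < G.mult univ x y :=
  (ncard_pos (toFinite _)).2 ⟨e, mem_univ _, h⟩

lemma exists_of_mult_pos [Finite E] {x y : V} (h : 0 < G.mult F x y) :
    ∃ e ∈ F, G.inc e = {x, y} :=
  (ncard_pos (toFinite _)).1 h

lemma ne_of_inc_eq {e : E} {x y : V} (h : G.inc e = {x, y}) : x ≠ y := by
  rintro rfl
  have := G.inc_nontrivial e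
  simp [h] at this

lemma inc_eq_pair (h2 : ∀ e, (G.inc e).ncard = 2) {e : E} {x y : V} (hx : x ∈ G.inc e)
    (hy : y ∈ G.inc e) (hxy : x ≠ y) : G.inc e = {x, y} := by
  symm
  refine eq_of_subset_of_ncard_le ?_ ?_ (finite_of_ncard_ne_zero (by rw [h2 e]; simp))
  · rintro z (rfl | rfl) <;> assumption
  · rw [h2 e, ncard_pair hxy]

lemma mem_of_mem_forbidden {x y : V} {a b : ℕ} (h : b ∈ G.forbidden L M x y a) : b ∈ L y := by
  simp only [forbidden, Finset.mem_filter] at h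
  exact h.1

lemma mem_forbidden_symm {x y : V} {a b : ℕ} (ha : a ∈ L x) (h : b ∈ G.forbidden L M x y a) :
    a ∈ G.forbidden L M y x b := by
  simp only [forbidden, Finset.mem_filter] at h ⊢
  obtain ⟨-, e, he, φ, hφ, h1, h2⟩ := h
  exact ⟨ha, e, by rw [he, pair_comm], φ, hφ, h2, h1⟩

lemma Violates.mem_forbidden {c : V → ℕ} {e : E} {x y : V} (h : G.Violates M c e)
    (he : G.inc e = {x, y}) (hy : c y ∈ L y) : c y ∈ G.forbidden L M x y (c x) := by
  obtain ⟨φ, hφ, hc⟩ := h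
  simp only [forbidden, Finset.mem_filter]
  exact ⟨hy, e, he, φ, hφ, (hc (by simp [he])).symm, (hc (by simp [he])).symm⟩

lemma card_forbidden_le [Finite E] (hM : G.IsMatched M) (x y : V) (a : ℕ) :
    (G.forbidden L M x y a).card ≤ G.mult univ x y := by
  rcases (G.forbidden L M x y a).eq_empty_or_nonempty with h | ⟨b₀, hb₀⟩
  · simp [h]
  have key : ∀ b ∈ G.forbidden L M x y a, ∃ e, G.inc e = {x, y} ∧ ∃ φ ∈ M e, φ x = a ∧ φ y = b :=
    fun b hb => by
      simp only [forbidden, Finset.mem_filter] at hb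
      exact hb.2
  have : Nonempty E := ⟨(key b₀ hb₀).choose⟩
  choose! f hf hφ using key
  rw [← ncard_coe_finset]
  refine ncard_le_ncard_of_injOn f (fun b hb => ⟨mem_univ _, hf b hb⟩) (fun b hb d hd hbd => ?_)
    (toFinite _)
  obtain ⟨φ, h1, h2, h3⟩ := hφ b hb
  obtain ⟨ψ, h1', h2', h3'⟩ := hφ d hd
  rw [← h3, ← h3']
  rw [← hbd] at h1'
  exact hM _ φ h1 ψ h1' x (by simp [hf b hb]) (h2.trans h2'.symm) (by simp [hf b hb])

lemma degOn_eq_add_mult [Finite E] (h2 : ∀ e, (G.inc e).ncard = 2) {x y : V} (hxy : x ≠ y) :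
    G.degOn F y = G.degOn {e | e ∈ F ∧ x ∉ G.inc e} y + G.mult F x y := by
  unfold degOn mult
  rw [← ncard_union_eq ?_ (toFinite _) (toFinite _)]
  · congr 1
    ext e
    simp only [mem_ofPred_eq, mem_union]
    constructor
    · rintro ⟨he, hy⟩
      by_cases hx : x ∈ G.inc e
      · exact Or.inr ⟨he, inc_eq_pair h2 hx hy hxy⟩
      · exact Or.inl ⟨⟨he, hx⟩, hy⟩
    · rintro (⟨⟨he, -⟩, hy⟩ | ⟨he, hinc⟩)
      · exact ⟨he, hy⟩
      · exact ⟨he, by simp [hinc]⟩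
  · rw [disjoint_left]
    rintro e ⟨⟨-, hx⟩, -⟩ ⟨-, hinc⟩
    exact hx (by simp [hinc])

lemma mult_of_forall [Finite E] {x y : V} (h : ∀ e, G.inc e = {x, y} → e ∈ F) :
    G.mult F x y = G.mult univ x y := by
  unfold mult
  congr 1
  ext e
  simp only [mem_ofPred_eq, mem_univ, true_and, and_iff_right_iff_imp]
  exact h e

/-- If the color `a` at `x` forbade fewer colors at `y` than there are edges between them, then
after coloring `x` the vertex `y` would have a spare color, and the connected rest `R \ {x}` could
be colored greedily. -/
lemma card_forbidden_eq [Finite V] [Finite E] (h2 : ∀ e, (G.inc e).ncard = 2)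
    (hF : ∀ e, e ∈ F ↔ G.inc e ⊆ R) (hM : G.IsMatched M)
    (hdeg : ∀ x ∈ R, G.degOn F x ≤ (L x).card) (hunc : G.Uncolorable R F L M) {x y : V}
    (hsep : G.ConnOn (R \ {x}) F) (hx : x ∈ R) (hy : y ∈ R) (hxy : x ≠ y) {a : ℕ} (ha : a ∈ L x) :
    (G.forbidden L M x y a).card = G.mult univ x y := by
  classical
  refine le_antisymm (card_forbidden_le hM x y a) ?_
  by_contra! hlt
  have hmult : G.mult F x y = G.mult univ x y := mult_of_forall fun e he => by
    rw [hF, he]; rintro z (rfl | rfl) <;> assumption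
  have hdegy := degOn_eq_add_mult h2 hxy (F := F)
  obtain ⟨c', h1, h3, h4⟩ := exists_extension (R := R \ {x}) (F := F) (L := L) hM (fun _ => a)
    (fun z hz => hdeg z hz.1) (fun Q hQ hne => by
      by_cases hyQ : y ∈ Q
      · left
        refine ⟨y, hyQ, fun c' hc' => ?_⟩
        have hyd := hdeg y hy
        obtain ⟨d, hd, hdN, h⟩ := exists_color hM c' {e | e ∈ F ∧ x ∉ G.inc e} y (L y)
          (G.forbidden L M x y a) (by omega)
        refine ⟨d, hd, fun e he hye => ?_⟩
        by_cases hxe : x ∈ G.inc e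
        · intro hv
          have := hv.mem_forbidden (L := L) (inc_eq_pair h2 hxe hye hxy) (by simpa using hd)
          rw [update_self, update_of_ne hxy, hc' (by simp)] at this
          exact hdN this
        · exact h e ⟨he, hxe⟩ hye
      · right
        exact hsep Q hQ hne ⟨y, ⟨hy, Ne.symm hxy⟩, hyQ⟩)
  have hx' : c' x = a := h1 (by simp)
  obtain ⟨e, he, hv⟩ := hunc c' (fun z hz => by
    by_cases hzx : z = x
    · subst hzx; rwa [hx']
    · exact h3 z ⟨hz, hzx⟩)
  obtain ⟨z, hz, hzx⟩ := (G.inc_nontrivial e).exists_ne x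
  exact h4 e he ⟨z, hz, (hF e).1 he hz, hzx⟩ hv

/-- Double counting: by `card_forbidden_eq`, forbiddance is a bipartite relation between the two
lists in which every color on either side has degree `mult`, and this is positive. -/
lemma card_eq_of_adj [Finite V] [Finite E] (h2 : ∀ e, (G.inc e).ncard = 2)
    (hF : ∀ e, e ∈ F ↔ G.inc e ⊆ R) (hM : G.IsMatched M)
    (hdeg : ∀ x ∈ R, G.degOn F x ≤ (L x).card) (hunc : G.Uncolorable R F L M)
    (hsep : ∀ x ∈ R, G.ConnOn (R \ {x}) F) {e : E} (he : e ∈ F) {x y : V}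
    (hxy : G.inc e = {x, y}) : (L x).card = (L y).card := by
  have hx : x ∈ R := (hF e).1 he (by simp [hxy])
  have hy : y ∈ R := (hF e).1 he (by simp [hxy])
  have hne : x ≠ y := ne_of_inc_eq hxy
  refine Nat.eq_of_mul_eq_mul_right (mult_pos hxy) ?_
  refine Finset.card_mul_eq_card_mul (fun a b => b ∈ G.forbidden L M x y a) (fun a ha => ?_)
    (fun b hb => ?_)
  · rw [← card_forbidden_eq h2 hF hM hdeg hunc (hsep x hx) hx hy hne ha]
    congr 1
    ext b
    simp only [Finset.mem_bipartiteAbove, and_iff_right_iff_imp]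
    exact fun h => mem_of_mem_forbidden h
  · rw [mult_comm, ← card_forbidden_eq h2 hF hM hdeg hunc (hsep y hy) hy hx hne.symm hb]
    congr 1
    ext a
    simp only [Finset.mem_bipartiteBelow]
    constructor
    · rintro ⟨ha, h⟩
      exact mem_forbidden_symm ha h
    · intro h
      exact ⟨mem_of_mem_forbidden h, mem_forbidden_symm hb h⟩

/-- List sizes equal degrees by `ConnOn.card_le` and are constant along edges. The relative form in
`R` and `F` allows an application to `G - u`. -/
lemma degOn_eq_of_uncolorable [Finite V] [Finite E] (h2 : ∀ e, (G.inc e).ncard = 2)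
    (hF : ∀ e, e ∈ F ↔ G.inc e ⊆ R) (hM : G.IsMatched M)
    (hdeg : ∀ x ∈ R, G.degOn F x ≤ (L x).card) (hunc : G.Uncolorable R F L M)
    (hconn : G.ConnOn R F) (hsep : ∀ x ∈ R, G.ConnOn (R \ {x}) F) {x y : V} (hx : x ∈ R)
    (hy : y ∈ R) : G.degOn F x = G.degOn F y := by
  have hcard : ∀ x ∈ R, (L x).card = G.degOn F x := fun x hx =>
    le_antisymm (hconn.card_le hM hdeg (fun e he => by
      obtain ⟨z, hz⟩ := (G.inc_nontrivial e).nonempty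
      exact ⟨z, hz, (hF e).1 he hz⟩) hunc hx) (hdeg x hx)
  by_contra hne
  obtain ⟨e, he, ⟨z, hze, hz⟩, ⟨z', hze', hz'⟩⟩ := hconn {z | z ∈ R ∧ G.degOn F z = G.degOn F x}
    (fun _ h => h.1) ⟨x, hx, rfl⟩ ⟨y, hy, fun h => hne h.2.symm⟩
  refine hz'.2 ⟨hz'.1, ?_⟩
  have hzz' : z ≠ z' := by rintro rfl; exact hz'.2 hz
  rw [← hz.2, ← hcard z hz.1, ← hcard z' hz'.1]
  exact (card_eq_of_adj h2 hF hM hdeg hunc hsep he (inc_eq_pair h2 hze hze' hzz')).symm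

/-- Color `u` and delete the colors this forbids elsewhere: `G - u` remains bad, hence is regular,
like `G`. The degrees in `G` and `G - u` differ by the multiplicity of the pair with `u`, which is
therefore constant. -/
lemma mult_eq_of_connOn [Finite V] [Finite E] (h2 : ∀ e, (G.inc e).ncard = 2)
    (hM : G.IsMatched M) (hdeg : ∀ x ∈ univ, G.degOn univ x ≤ (L x).card)
    (hunc : G.Uncolorable univ univ L M) (hconn : G.ConnOn univ univ)
    (hsep : ∀ x, G.ConnOn {x}ᶜ univ) {u x y : V}
    (hu : ∀ w ≠ u, G.ConnOn ({u}ᶜ \ {w}) univ) (hx : x ≠ u) (hy : y ≠ u) :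
    G.mult univ u x = G.mult univ u y := by
  classical
  have hF : ∀ e, e ∈ (univ : Set E) ↔ G.inc e ⊆ univ := by simp
  have hsep' : ∀ x ∈ univ, G.ConnOn (univ \ {x}) univ := fun x _ => by
    rw [← compl_eq_univ_sdiff]; exact hsep x
  have hreg := degOn_eq_of_uncolorable h2 hF hM hdeg hunc hconn hsep' (mem_univ x) (mem_univ y)
  -- restrict to the edges away from `u`
  have hconv : ∀ S ⊆ ({u}ᶜ : Set V), G.ConnOn S univ → G.ConnOn S {e | e ∈ univ ∧ u ∉ G.inc e} := by
    intro S hS h Q hQ h1 h3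
    obtain ⟨e, -, ⟨z, hz, hzQ⟩, ⟨z', hz', hzQ'⟩⟩ := h Q hQ h1 h3
    refine ⟨e, ⟨mem_univ _, ?_⟩, ⟨z, hz, hzQ⟩, ⟨z', hz', hzQ'⟩⟩
    rw [inc_eq_pair h2 hz hz' (by rintro rfl; exact hzQ'.2 hzQ)]
    rintro (rfl | rfl)
    · exact hS (hQ hzQ) rfl
    · exact hS hzQ'.1 rfl
  have hpos : 0 < (L u).card := by
    obtain ⟨e, -, ⟨z, hz, hzu⟩, -⟩ := hconn {u} (subset_univ _) (singleton_nonempty u)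
      ⟨x, mem_univ _, hx⟩
    rw [mem_singleton_iff.1 hzu] at hz
    exact ((ncard_pos (toFinite _)).2 ⟨e, mem_univ _, hz⟩ : 0 < G.degOn univ u).trans_le
      (hdeg u (mem_univ u))
  obtain ⟨a, ha⟩ := Finset.card_pos.1 hpos
  have hreg' := degOn_eq_of_uncolorable (R := {u}ᶜ) (F := {e | e ∈ univ ∧ u ∉ G.inc e})
    (L := fun z => L z \ G.forbidden L M u z a) h2
    (fun e => by simp) hM
    (fun z hz => by
      have h1 := degOn_eq_add_mult h2 (Ne.symm hz) (F := univ)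
      have h3 := card_forbidden_le (L := L) hM u z a
      have h4 := Finset.le_card_sdiff (G.forbidden L M u z a) (L z)
      have h5 := hdeg z (mem_univ _)
      omega)
    (fun c hc => by
      obtain ⟨e, -, hv⟩ := hunc (update c u a) (fun z _ => by
        by_cases hz : z = u
        · subst hz; simpa using ha
        · rw [update_of_ne hz]
          exact (Finset.mem_sdiff.1 (hc z hz)).1)
      by_cases hue : u ∈ G.inc e
      · exfalso
        obtain ⟨z, hz, hzu⟩ := (G.inc_nontrivial e).exists_ne u
        have hcz := Finset.mem_sdiff.1 (hc z hzu)
        have := hv.mem_forbidden (L := L) (inc_eq_pair h2 hue hz (Ne.symm hzu))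
          (by rw [update_of_ne hzu]; exact hcz.1)
        rw [update_of_ne hzu, update_self] at this
        exact hcz.2 this
      · exact ⟨e, ⟨mem_univ _, hue⟩, hv.congr fun z hz =>
          update_of_ne (by rintro rfl; exact hue hz) _ _⟩)
    (hconv _ subset_rfl (hsep u))
    (fun w hw => hconv _ sdiff_subset (hu w hw)) hx hy
  have h1 := degOn_eq_add_mult h2 (Ne.symm hx) (F := univ)
  have h3 := degOn_eq_add_mult h2 (Ne.symm hy) (F := univ)
  omega

/-- If every side of a separation contains a vertex with the property `P`, then every side also
contains such a vertex that does not separate. -/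
lemma exists_connOn_sdiff [Finite V] {P : V → Prop} (hconn : G.ConnOn R F)
    (hP : ∀ w ∈ R, ∀ S ⊆ R \ {w}, S.Nonempty → ((R \ {w}) \ S).Nonempty →
      (∀ e ∈ F, (G.inc e ∩ S).Nonempty → ¬ (G.inc e ∩ ((R \ {w}) \ S)).Nonempty) → ∃ x ∈ S, P x) :
    ∀ n : ℕ, ∀ w ∈ R, ∀ S ⊆ R \ {w}, S.ncard = n → S.Nonempty → ((R \ {w}) \ S).Nonempty →
      (∀ e ∈ F, (G.inc e ∩ S).Nonempty → ¬ (G.inc e ∩ ((R \ {w}) \ S)).Nonempty) →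
      ∃ x ∈ S, P x ∧ G.ConnOn (R \ {x}) F := by
  intro n
  induction n using Nat.strong_induction_on with
  | _ n ih =>
    intro w hw S hS hn hne hne' hST
    obtain ⟨x, hxS, hPx⟩ := hP w hw S hS hne hne' hST
    by_cases hx : G.ConnOn (R \ {x}) F
    · exact ⟨x, hxS, hPx, hx⟩
    have hxR := hS hxS
    have key : ∀ Q ⊆ R \ {x}, Q.Nonempty → ((R \ {x}) \ Q).Nonempty → w ∉ Q →
        (∀ e ∈ F, (G.inc e ∩ Q).Nonempty → ¬ (G.inc e ∩ ((R \ {x}) \ Q)).Nonempty) →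
        ∃ x ∈ S, P x ∧ G.ConnOn (R \ {x}) F := by
      intro Q hQ hQne hQne' hwQ hQe
      -- A side of `x` avoiding `w` lies inside `S`: otherwise `Q \ S` would be joined to the rest
      -- by an edge, which must leave both `Q` and `S`, and no edge can do so. As `x ∉ Q`, the side
      -- shrinks strictly.
      have hQS : Q ⊆ S := by
        by_contra hQS
        obtain ⟨y, hyQ, hyS⟩ := not_subset.1 hQS
        obtain ⟨e, he, ⟨z, hz, hzQ⟩, ⟨z', hz', hzQ'⟩⟩ := hconn (Q \ S)
          (fun t ht => (hQ ht.1).1) ⟨y, hyQ, hyS⟩ ⟨x, hxR.1, fun h => h.2 hxS⟩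
        have hzw : z ≠ w := by rintro rfl; exact hwQ hzQ.1
        have hz'S : z' ∉ S := fun h => hST e he ⟨z', hz', h⟩ ⟨z, hz, ⟨(hQ hzQ.1).1, hzw⟩, hzQ.2⟩
        have hz'Q : z' ∉ Q := fun h => hzQ'.2 ⟨h, hz'S⟩
        exact hQe e he ⟨z, hz, hzQ.1⟩ ⟨z', hz', ⟨hzQ'.1, by rintro rfl; exact hz'S hxS⟩, hz'Q⟩
      have hlt : Q.ncard < S.ncard :=
        ncard_lt_ncard ⟨hQS, fun h => (hQ (h hxS)).2 rfl⟩ (toFinite _)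
      obtain ⟨y, hy, h⟩ := ih Q.ncard (hn ▸ hlt) x hxR.1 Q hQ rfl hQne hQne' hQe
      exact ⟨y, hQS hy, h⟩
    unfold ConnOn at hx
    push Not at hx
    obtain ⟨Q, hQ, hQne, hQne', hQe⟩ := hx
    by_cases hwQ : w ∈ Q
    · refine key ((R \ {x}) \ Q) sdiff_subset hQne' ?_ (fun h => h.2 hwQ) ?_
      · rwa [sdiff_sdiff_cancel_left hQ]
      · intro e he h1 h3
        rw [sdiff_sdiff_cancel_left hQ] at h3
        exact h1.ne_empty (hQe e he h3)
    · exact key Q hQ hQne hQne' hwQ fun e he h1 h3 => h3.ne_empty (hQe e he h1)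

/-- Since `G - {u, x}` is connected, an edge leaves `P ∩ S`. It cannot enter `T`, so it ends in `S ∪
{w}`, hence outside `P` and away from `y`. This keeps the graph connected when both `x` and `y` are
deleted along with `u`. -/
lemma exists_edge_of_sides {u w x y : V} {S T : Set V}
    (hST : ∀ z, z ≠ u → z ≠ w → z ∈ S ∨ z ∈ T)
    (hwu : w ≠ u) (hwS : w ∉ S) (huS : u ∉ S)
    (hedge : ∀ e z z', z ∈ S → z' ∈ T → z ∈ G.inc e → z' ∉ G.inc e)
    (hxS : x ∈ S) (hyT : y ∈ T) (hx : G.ConnOn ({u}ᶜ \ {x}) univ)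
    {P : Set V} (hP : P ⊆ {u, x, y}ᶜ) (hwP : w ∉ P) (hPS : (P ∩ S).Nonempty) :
    ∃ e, (G.inc e ∩ P).Nonempty ∧ (G.inc e ∩ ({u, x, y}ᶜ \ P)).Nonempty := by
  obtain ⟨e, -, ⟨z, hz, hzP⟩, ⟨z', hz', hzP'⟩⟩ := hx (P ∩ S)
    (fun z hz => ⟨fun h => huS (by rw [mem_singleton_iff.1 h] at hz; exact hz.2),
      fun h => hP hz.1 (by simp [mem_singleton_iff.1 h])⟩) hPS
    ⟨w, ⟨hwu, by rintro rfl; exact hwS hxS⟩, fun h => hwP h.1⟩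
  have hzu : z' ≠ u := hzP'.1.1
  have hzx : z' ≠ x := hzP'.1.2
  have hz'T : z' ∉ T := fun h => hedge e z z' hzP.2 h hz hz'
  have hzy : z' ≠ y := by rintro rfl; exact hz'T hyT
  refine ⟨e, ⟨z, hz, hzP.1⟩, ⟨z', hz', by simp [hzu, hzx, hzy], fun h => ?_⟩⟩
  by_cases hzw : z' = w
  · exact hwP (hzw ▸ h)
  · exact hzP'.2 ⟨h, (hST z' hzu hzw).resolve_right hz'T⟩

/-- The colors `a` at `x` and `b` at `y` both forbid `z` at `u`, so together they waste one edge at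
`u`: this is how `u` acquires a spare color. -/
lemma exists_forbidden_inter [Finite V] [Finite E] (h2 : ∀ e, (G.inc e).ncard = 2)
    (hM : G.IsMatched M) (hdeg : ∀ x ∈ univ, G.degOn univ x ≤ (L x).card)
    (hunc : G.Uncolorable univ univ L M)
    (hsep : ∀ x, G.ConnOn {x}ᶜ univ) {u x y : V} {e : E} (hx : G.inc e = {x, u}) :
    ∃ a ∈ L x, ∃ z ∈ G.forbidden L M x u a,
      ∀ b ∈ G.forbidden L M u y z,
      (G.forbidden L M x u a ∪ G.forbidden L M y u b).card < G.mult univ x u + G.mult univ y u := by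
  have hF : ∀ e, e ∈ (univ : Set E) ↔ G.inc e ⊆ univ := by simp
  have hsep' : ∀ x, G.ConnOn (univ \ {x}) univ := fun x => by
    rw [← compl_eq_univ_sdiff]; exact hsep x
  have hpos : 0 < G.degOn univ x := (ncard_pos (toFinite _)).2 ⟨e, mem_univ _, by simp [hx]⟩
  obtain ⟨a, ha⟩ := Finset.card_pos.1 (hpos.trans_le (hdeg x (mem_univ x)))
  have hcx := card_forbidden_eq h2 hF hM hdeg hunc (hsep' x) (mem_univ x) (mem_univ u)
    (ne_of_inc_eq hx) ha
  obtain ⟨z, hz⟩ := Finset.card_pos.1 (hcx ▸ mult_pos hx)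
  have hzu : z ∈ L u := mem_of_mem_forbidden hz
  refine ⟨a, ha, z, hz, fun b hb => ?_⟩
  have hzb := mem_forbidden_symm hzu hb
  have h1 := Finset.card_union_add_card_inter (G.forbidden L M x u a) (G.forbidden L M y u b)
  have h3 : 0 < (G.forbidden L M x u a ∩ G.forbidden L M y u b).card :=
    Finset.card_pos.2 ⟨z, Finset.mem_inter.2 ⟨hz, hzb⟩⟩
  have h4 := card_forbidden_le (L := L) hM y u b
  omega

lemma degOn_eq_add_mult_add_mult [Finite E] (h2 : ∀ e, (G.inc e).ncard = 2) {u x y : V}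
    (hx : x ≠ u) (hy : y ≠ u) (hxy : x ≠ y) :
    G.degOn univ u = G.degOn {e | x ∉ G.inc e ∧ y ∉ G.inc e} u + G.mult univ x u
      + G.mult univ y u := by
  have h1 := degOn_eq_add_mult h2 hx (F := univ)
  have h3 := degOn_eq_add_mult h2 hy (F := {e | e ∈ univ ∧ x ∉ G.inc e})
  have h4 : G.mult {e | e ∈ univ ∧ x ∉ G.inc e} y u = G.mult univ y u :=
    mult_of_forall fun e he => ⟨mem_univ _, by simp [he, hx, hxy]⟩
  have h5 : ({e | e ∈ {e | e ∈ univ ∧ x ∉ G.inc e} ∧ y ∉ G.inc e} : Set E) =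
      {e | x ∉ G.inc e ∧ y ∉ G.inc e} := by ext; simp
  rw [h5] at h3
  omega

/-- A vertex whose deletion leaves a separating vertex has exactly two neighbors. -/
lemma exists_two_neighbors [Finite V] [Finite E] (h2 : ∀ e, (G.inc e).ncard = 2)
    (hM : G.IsMatched M) (hdeg : ∀ x ∈ univ, G.degOn univ x ≤ (L x).card)
    (hunc : G.Uncolorable univ univ L M) (hsep : ∀ x, G.ConnOn {x}ᶜ univ) {u w : V} (hwu : w ≠ u)
    (hu : ¬ G.ConnOn ({u}ᶜ \ {w}) univ) :
    ∃ x y, x ≠ y ∧ (∃ e, G.inc e = {x, u}) ∧ (∃ e, G.inc e = {y, u}) ∧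
      (¬ ∃ e, G.inc e = {x, y}) ∧ ∀ z, (∃ e, G.inc e = {z, u}) → z = x ∨ z = y := by
  classical
  have hF : ∀ e, e ∈ (univ : Set E) ↔ G.inc e ⊆ univ := by simp
  have hsep' : ∀ x, G.ConnOn (univ \ {x}) univ := fun x => by
    rw [← compl_eq_univ_sdiff]; exact hsep x
  unfold ConnOn at hu
  push Not at hu
  obtain ⟨S, hS, hSne, hTne, hSe⟩ := hu
  have hchoose := exists_connOn_sdiff (G := G) (R := {u}ᶜ) (F := univ)
    (P := fun x => ∃ e, G.inc e = {x, u}) (hsep u) (fun w hw S hS hSne hTne hSe => by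
      obtain ⟨e, -, ⟨z, hz, hzS⟩, ⟨z', hz', hzS'⟩⟩ := hsep w S (fun z hz => (hS hz).2) hSne
        ⟨u, Ne.symm hw, fun h => (hS h).1 rfl⟩
      refine ⟨z, hzS, e, inc_eq_pair h2 hz ?_ (hS hzS).1⟩
      by_contra hue
      refine hSe e (mem_univ e) ⟨z, hz, hzS⟩ ⟨z', hz', ⟨?_, hzS'.1⟩, hzS'.2⟩
      rintro rfl
      exact hue hz')
  -- In each side of `w` in `G - u`, choose a neighbor of `u` whose deletion leaves `G - u`
  -- connected.
  obtain ⟨x, hxS, ⟨e₁, he₁⟩, hxconn⟩ := hchoose _ w hwu S hS rfl hSne hTne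
    (fun e he _ h => h.ne_empty (hSe e he (by assumption)))
  set T := ({u}ᶜ \ {w}) \ S with hT
  obtain ⟨y, hyT, ⟨e₂, he₂⟩, hyconn⟩ := hchoose _ w hwu T sdiff_subset rfl hTne
    (by rwa [hT, sdiff_sdiff_cancel_left hS])
    (fun e he h1 h3 => by
      rw [hT, sdiff_sdiff_cancel_left hS] at h3
      exact h1.ne_empty (hSe e he h3))
  have hedge : ∀ e z z', z ∈ S → z' ∈ T → z ∈ G.inc e → z' ∉ G.inc e := by
    intro e z z' hz hz' hze hze'
    have : z' ∈ G.inc e ∩ T := ⟨hze', hz'⟩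
    rw [hSe e (mem_univ e) ⟨z, hze, hz⟩] at this
    exact this.elim
  have hxy : x ≠ y := by rintro rfl; exact hyT.2 hxS
  have hnadj : ¬ ∃ e, G.inc e = {x, y} := by
    rintro ⟨e, he⟩
    exact hedge e x y hxS hyT (by simp [he]) (by simp [he])
  have hwS : w ∉ S := fun h => (hS h).2 rfl
  have hwT : w ∉ T := fun h => h.1.2 rfl
  have huS : u ∉ S := fun h => (hS h).1 rfl
  have huT : u ∉ T := fun h => h.1.1 rfl
  have hcov : ∀ z, z ≠ u → z ≠ w → z ∈ S ∨ z ∈ T := by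
    intro z hzu hzw
    by_cases hz : z ∈ S
    · exact Or.inl hz
    · exact Or.inr ⟨⟨hzu, hzw⟩, hz⟩
  have hxu : x ≠ u := ne_of_inc_eq he₁
  have hyu : y ≠ u := ne_of_inc_eq he₂
  have hxw : x ≠ w := by rintro rfl; exact hwS hxS
  have hyw : y ≠ w := by rintro rfl; exact hwT hyT
  refine ⟨x, y, hxy, ⟨e₁, he₁⟩, ⟨e₂, he₂⟩, hnadj, ?_⟩
  rintro t ⟨e₃, he₃⟩
  by_contra! htxy
  have htu : t ≠ u := ne_of_inc_eq he₃
  have hinner : ∀ P ⊆ ({u, x, y}ᶜ : Set V), P.Nonempty → w ∉ P →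
      ∃ e, (G.inc e ∩ P).Nonempty ∧ (G.inc e ∩ ({u, x, y}ᶜ \ P)).Nonempty := by
    rintro P hP ⟨p, hp⟩ hwP
    have hpP := hP hp
    simp only [mem_compl_iff, mem_insert_iff, mem_singleton_iff, not_or] at hpP
    rcases hcov p hpP.1 (by rintro rfl; exact hwP hp) with hpS | hpT
    · exact exists_edge_of_sides hcov hwu hwS huS hedge hxS hyT
        hxconn hP hwP ⟨p, hp, hpS⟩
    · have := exists_edge_of_sides (fun z h1 h3 => (hcov z h1 h3).symm)
        hwu hwT huT
        (fun e z z' hz hz' h1 h3 => hedge e z' z hz' hz h3 h1) hyT hxS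
        hyconn (P := P) (by rwa [pair_comm y x]) hwP ⟨p, hp, hpT⟩
      rwa [pair_comm y x] at this
  obtain ⟨a, ha, z, hz, hzb⟩ := exists_forbidden_inter (y := y) h2 hM hdeg hunc hsep he₁
  have hzu : z ∈ L u := mem_of_mem_forbidden hz
  obtain ⟨b, hb⟩ := Finset.card_pos.1 ((card_forbidden_eq h2 hF hM hdeg hunc (hsep' u) (mem_univ u)
    (mem_univ y) hyu.symm hzu).symm ▸ (mult_comm y u ▸ mult_pos he₂) :
      0 < (G.forbidden L M u y z).card)
  have hlt := hzb b hb
  have hdegu := degOn_eq_add_mult_add_mult h2 hxu hyu hxy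
  have hdegu' := hdeg u (mem_univ u)
  -- A third neighbor `t` would keep `G - {x, y}` connected. As `x` and `y` are nonadjacent, they
  -- may take the colors `a` and `b`, after which `u` has a spare color and greedy coloring
  -- contradicts badness.
  obtain ⟨c', h1, h3, h4⟩ := exists_extension (R := {x, y}ᶜ) (F := univ) (L := L) hM
    (update (fun _ => a) y b) (fun z _ => hdeg z (mem_univ z)) (fun Q hQ hne => by
      by_cases huQ : u ∈ Q
      · left
        refine ⟨u, huQ, fun c' hc' => ?_⟩
        have hcx : c' x = a := by rw [hc' (by simp), update_of_ne hxy]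
        have hcy : c' y = b := by rw [hc' (by simp), update_self]
        obtain ⟨d, hd, hdN, h⟩ := exists_color hM c' {e | x ∉ G.inc e ∧ y ∉ G.inc e} u (L u)
          (G.forbidden L M x u a ∪ G.forbidden L M y u b) (by omega)
        simp only [Finset.mem_union, not_or] at hdN
        refine ⟨d, hd, fun e _ hue hv => ?_⟩
        by_cases hxe : x ∈ G.inc e
        · have := hv.mem_forbidden (L := L) (inc_eq_pair h2 hxe hue hxu) (by simpa using hd)
          rw [update_self, update_of_ne hxu, hcx] at this
          exact hdN.1 this
        · by_cases hye : y ∈ G.inc e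
          · have := hv.mem_forbidden (L := L) (inc_eq_pair h2 hye hue hyu) (by simpa using hd)
            rw [update_self, update_of_ne hyu, hcy] at this
            exact hdN.2 this
          · exact h e ⟨hxe, hye⟩ hue hv
      · right
        have hQ' : Q ⊆ ({u, x, y}ᶜ : Set V) := by
          intro s hs
          have := hQ hs
          simp only [mem_compl_iff, mem_insert_iff, mem_singleton_iff, not_or] at this ⊢
          exact ⟨by rintro rfl; exact huQ hs, this⟩
        have hsub : ({u, x, y}ᶜ : Set V) ⊆ {x, y}ᶜ := compl_subset_compl.2 (subset_insert _ _)
        by_cases hwQ : w ∈ Q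
        · rcases ({u, x, y}ᶜ \ Q : Set V).eq_empty_or_nonempty with hemp | hne'
          -- Only here is `t` needed: when `Q` is everything but `u`, the edge from `t` connects it
          -- to `u`.
          · refine ⟨e₃, mem_univ _, ⟨t, by simp [he₃], ?_⟩, ⟨u, by simp [he₃], ?_, huQ⟩⟩
            · rw [sdiff_eq_empty] at hemp
              exact hemp (by simp [htu, htxy])
            · simp [hxu.symm, hyu.symm]
          · obtain ⟨e, h1, h3⟩ := hinner _ sdiff_subset hne' (fun h => h.2 hwQ)
            rw [sdiff_sdiff_cancel_left hQ'] at h3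
            exact ⟨e, mem_univ _, h3, h1.mono (inter_subset_inter_right _ (sdiff_subset_sdiff_left hsub))⟩
        · obtain ⟨e, h1, h3⟩ := hinner Q hQ' hne hwQ
          exact ⟨e, mem_univ _, h1, h3.mono (inter_subset_inter_right _ (sdiff_subset_sdiff_left hsub))⟩)
  have hbL : b ∈ L y := mem_of_mem_forbidden hb
  obtain ⟨e, -, hv⟩ := hunc c' (fun z _ => by
    by_cases hzx : z = x
    · subst hzx; rw [h1 (by simp), update_of_ne hxy]; exact ha
    · by_cases hzy : z = y
      · subst hzy; rw [h1 (by simp), update_self]; exact hbL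
      · exact h3 z (by simp [hzx, hzy]))
  refine h4 e (mem_univ e) ?_ hv
  by_contra hemp
  obtain ⟨z₁, hz₁, z₂, hz₂, hz₁₂⟩ := G.inc_nontrivial e
  have hsub : ∀ z ∈ G.inc e, z = x ∨ z = y := by
    intro z hz
    by_contra h
    exact hemp ⟨z, hz, by simpa using h⟩
  refine hnadj ⟨e, ?_⟩
  rcases hsub z₁ hz₁ with rfl | rfl <;> rcases hsub z₂ hz₂ with rfl | rfl
  · exact absurd rfl hz₁₂
  · exact inc_eq_pair h2 hz₁ hz₂ hz₁₂
  · exact inc_eq_pair h2 hz₂ hz₁ hz₁₂.symm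
  · exact absurd rfl hz₁₂

/-- At a vertex with exactly two neighbors, the two multiplicities agree. -/
lemma mult_le_of_two_neighbors [Finite V] [Finite E] (h2 : ∀ e, (G.inc e).ncard = 2)
    (hM : G.IsMatched M) (hdeg : ∀ x ∈ univ, G.degOn univ x ≤ (L x).card)
    (hunc : G.Uncolorable univ univ L M) (hconn : G.ConnOn univ univ)
    (hsep : ∀ x, G.ConnOn {x}ᶜ univ) {u x y : V}
    (hxy : x ≠ y) (hx : ∃ e, G.inc e = {x, u}) (hy : ∃ e, G.inc e = {y, u})
    (hnb : ∀ z, (∃ e, G.inc e = {z, u}) → z = x ∨ z = y) :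
    G.mult univ y u ≤ G.mult univ x u := by
  classical
  have hF : ∀ e, e ∈ (univ : Set E) ↔ G.inc e ⊆ univ := by simp
  have hsep' : ∀ x, G.ConnOn (univ \ {x}) univ := fun x => by
    rw [← compl_eq_univ_sdiff]; exact hsep x
  have hreg := degOn_eq_of_uncolorable h2 hF hM hdeg hunc hconn (fun x _ => hsep' x) (mem_univ y)
    (mem_univ u)
  obtain ⟨e₁, he₁⟩ := hx
  obtain ⟨e₂, he₂⟩ := hy
  have hxu : x ≠ u := ne_of_inc_eq he₁
  have hyu : y ≠ u := ne_of_inc_eq he₂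
  obtain ⟨a, ha, z, hz, hzb⟩ := exists_forbidden_inter (y := y) h2 hM hdeg hunc hsep he₁
  have hzu : z ∈ L u := mem_of_mem_forbidden hz
  have hcard := card_forbidden_eq h2 hF hM hdeg hunc (hsep' u) (mem_univ u) (mem_univ y) hyu.symm hzu
  have hnbe : ∀ e, u ∈ G.inc e → x ∈ G.inc e ∨ y ∈ G.inc e := by
    intro e hue
    obtain ⟨t, ht, htu⟩ := (G.inc_nontrivial e).exists_ne u
    rcases hnb t ⟨e, inc_eq_pair h2 ht hue htu⟩ with rfl | rfl
    · exact Or.inl ht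
    · exact Or.inr ht
  have hdegu := degOn_eq_add_mult_add_mult h2 hxu hyu hxy
  have hzero : G.degOn {e | x ∉ G.inc e ∧ y ∉ G.inc e} u = 0 := by
    unfold degOn
    rw [ncard_eq_zero (toFinite _), eq_empty_iff_forall_notMem]
    rintro e ⟨⟨h1, h3⟩, hue⟩
    exact (hnbe e hue).elim h1 h3
  have hdegu' := hdeg u (mem_univ u)
  have hdegy := degOn_eq_add_mult h2 hyu.symm (F := univ)
  -- Colors at `y` that, with `a` at `x`, do not extend to `G - u`. If `y` takes a color forbidding
  -- `z`, a color remains for `u`, so the failure must occur in `G - u`. Hence `mult u y ≤ #B ≤ deg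
  -- y - mult u y`, and by regularity the right side is `deg u - mult u y`, that is, `mult x u`.
  let B : Finset ℕ := (L y).filter fun d => ¬ ∃ c : V → ℕ, c y = d ∧ c x = a ∧
    (∀ t, t ≠ x → t ≠ u → c t ∈ L t) ∧ ∀ e, u ∉ G.inc e → ¬ G.Violates M c e
  have hsub : G.forbidden L M u y z ⊆ B := by
    intro b hb
    have hbL : b ∈ L y := mem_of_mem_forbidden hb
    simp only [B, Finset.mem_filter, hbL, true_and]
    rintro ⟨c, hcy, hcx, hcL, hce⟩
    have hlt := hzb b hb
    obtain ⟨d, hd, hdN, -⟩ := exists_color hM c ∅ u (L u)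
      (G.forbidden L M x u a ∪ G.forbidden L M y u b) (by
        have : G.degOn ∅ u = 0 := by simp [degOn]
        omega)
    simp only [Finset.mem_union, not_or] at hdN
    obtain ⟨e, -, hv⟩ := hunc (update c u d) (fun t _ => by
      by_cases htu : t = u
      · subst htu; simpa using hd
      · rw [update_of_ne htu]
        by_cases htx : t = x
        · rw [htx, hcx]; exact ha
        · exact hcL t htx htu)
    by_cases hue : u ∈ G.inc e
    · rcases hnbe e hue with hxe | hye
      · have := hv.mem_forbidden (L := L) (inc_eq_pair h2 hxe hue hxu) (by simpa using hd)
        rw [update_self, update_of_ne hxu, hcx] at this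
        exact hdN.1 this
      · have := hv.mem_forbidden (L := L) (inc_eq_pair h2 hye hue hyu) (by simpa using hd)
        rw [update_self, update_of_ne hyu, hcy] at this
        exact hdN.2 this
    · exact hce e hue (hv.congr fun t ht => update_of_ne (by rintro rfl; exact hue ht) _ _)
  have hB : B.card ≤ G.degOn {e | e ∈ univ ∧ u ∉ G.inc e} y := by
    by_contra! hlt
    obtain ⟨c', h1, h3, h4⟩ := exists_extension (R := {x, u}ᶜ) (F := {e | e ∈ univ ∧ u ∉ G.inc e})
      (L := update L y B) hM (fun _ => a)
      (fun t _ => by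
        by_cases ht : t = y
        · subst ht; simpa using hlt.le
        · simpa [ht] using (degOn_mono (subset_univ _) t).trans (hdeg t (mem_univ _)))
      (fun Q hQ hne => by
        by_cases hyQ : y ∈ Q
        · left
          refine ⟨y, hyQ, fun c' _ => ?_⟩
          obtain ⟨d, hd, -, h⟩ := exists_color hM c' {e | e ∈ univ ∧ u ∉ G.inc e} y B ∅
            (by simpa using hlt)
          exact ⟨d, by simpa using hd, h⟩
        · right
          obtain ⟨e, -, ⟨t, ht, htQ⟩, ⟨t', ht', htQ'⟩⟩ := hsep x Q
            (fun t ht h => hQ ht (by simp [mem_singleton_iff.1 h])) hne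
            ⟨y, hxy.symm, hyQ⟩
          have htx := hQ htQ
          simp only [mem_compl_iff, mem_insert_iff, mem_singleton_iff, not_or] at htx
          have hue : u ∉ G.inc e := by
            intro hue
            rcases hnb t ⟨e, inc_eq_pair h2 ht hue htx.2⟩ with rfl | rfl
            · exact htx.1 rfl
            · exact hyQ htQ
          refine ⟨e, ⟨mem_univ _, hue⟩, ⟨t, ht, htQ⟩, ⟨t', ht', ?_, htQ'.2⟩⟩
          simp only [mem_compl_iff, mem_insert_iff, mem_singleton_iff, not_or]
          exact ⟨htQ'.1, by rintro rfl; exact hue ht'⟩)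
    have hyB : c' y ∈ B := by
      have := h3 y (by simp [hxy.symm, hyu])
      simpa using this
    simp only [B, Finset.mem_filter] at hyB
    refine hyB.2 ⟨c', rfl, h1 (by simp), fun t htx htu => ?_, fun e he => h4 e ⟨mem_univ _, he⟩ ?_⟩
    · by_cases hty : t = y
      · subst hty; exact hyB.1
      · simpa [hty] using h3 t (by simp [htx, htu])
    · obtain ⟨t, ht, htx⟩ := (G.inc_nontrivial e).exists_ne x
      refine ⟨t, ht, ?_⟩
      simp only [mem_compl_iff, mem_insert_iff, mem_singleton_iff, not_or]
      exact ⟨htx, by rintro rfl; exact he ht⟩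
  have h1 := Finset.card_le_card hsub
  have h3 := mult_comm (G := G) (F := univ) u y
  omega

end Multigraph

/-! ### Recognizing multiples of complete graphs and cycles -/

section Brick

variable {V : Type u} {E : Type v} {G : MultiHypergraph V E}

lemma nonempty_iso_multiple [Finite E] {n t : ℕ} (σ : V ≃ Fin n) (S : SimpleGraph (Fin n))
    (hE : ∀ e, ∃ x y, G.inc e = {x, y} ∧ S.Adj (σ x) (σ y))
    (hm : ∀ x y, S.Adj (σ x) (σ y) → G.mult univ x y = t) :
    Nonempty (G.Iso (multiple t S)) := by
  choose x y hinc hadj using hE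
  let f : E → S.edgeSet := fun e => ⟨s(σ (x e), σ (y e)), hadj e⟩
  have hf : ∀ e z, σ z ∈ (f e : Sym2 (Fin n)) ↔ z ∈ G.inc e := by
    intro e z
    simp [f, hinc e]
  have hcard : ∀ p : S.edgeSet, Nat.card {e // f e = p} = t := by
    rintro ⟨p, hp⟩
    induction p with
    | h a b =>
      have hp' : S.Adj a b := hp
      rw [← hm (σ.symm a) (σ.symm b) (by simpa using hp')]
      unfold mult
      rw [← Nat.card_coe_set_eq]
      refine Nat.card_congr (Equiv.subtypeEquivRight fun e => ?_)
      simp only [mem_univ, true_and, mem_ofPred_eq]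
      constructor
      · intro h
        ext z
        rw [← hf e z, h]
        simp [Equiv.eq_symm_apply]
      · intro h
        refine Subtype.ext (Sym2.ext fun i => ?_)
        obtain ⟨z, rfl⟩ := σ.surjective i
        rw [hf e z, h]
        simp [Equiv.eq_symm_apply]
  let ε : E ≃ S.edgeSet × Fin t := (Equiv.sigmaFiberEquiv f).symm.trans
    ((Equiv.sigmaCongrRight fun p => Finite.equivFinOfCardEq (hcard p)).trans
      (Equiv.sigmaEquivProd _ _))
  have hε : ∀ e, (ε e).1 = f e := fun e => rfl
  refine ⟨⟨σ, ε, fun e => ?_⟩⟩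
  ext i
  obtain ⟨z, rfl⟩ := σ.surjective i
  change σ z ∈ ((ε e).1 : Sym2 (Fin n)) ↔ _
  rw [hε, hf, σ.injective.mem_set_image]

lemma cycleGraph_adj_iff {n : ℕ} (hn : 3 ≤ n) (i j : Fin n) :
    (SimpleGraph.cycleGraph n).Adj i j ↔ (i : ℕ) + 1 = j ∨ (j : ℕ) + 1 = i ∨
      ((i : ℕ) = 0 ∧ (j : ℕ) + 1 = n) ∨ ((j : ℕ) = 0 ∧ (i : ℕ) + 1 = n) := by
  have key : ∀ i j : Fin n, ((i - j : Fin n) : ℕ) = 1 ↔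
      ((j : ℕ) + 1 = i ∨ ((i : ℕ) = 0 ∧ (j : ℕ) + 1 = n)) := by
    intro i j
    have hi := i.2
    have hj := j.2
    rw [Fin.sub_def]
    simp only
    by_cases h : (j : ℕ) ≤ i
    · have : n - (j : ℕ) + i = n + (i - j) := by omega
      rw [this, Nat.add_mod_left, Nat.mod_eq_of_lt (by omega)]
      omega
    · rw [Nat.mod_eq_of_lt (by omega)]
      omega
  rw [SimpleGraph.cycleGraph_adj', key, key]
  tauto

/-- A connected graph in which every vertex has exactly two neighbors is a cycle. -/
lemma exists_equiv_cycleGraph [Finite V] [Nonempty V] (S : SimpleGraph V)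
    (hconn : ∀ Q : Set V, Q.Nonempty → (∀ x ∈ Q, ∀ y, S.Adj x y → y ∈ Q) → Q = univ)
    (h2 : ∀ u, ∃ x y, x ≠ y ∧ ∀ z, S.Adj u z ↔ z = x ∨ z = y) :
    ∃ n, 3 ≤ n ∧ ∃ σ : V ≃ Fin n, ∀ x y, S.Adj x y ↔ (SimpleGraph.cycleGraph n).Adj (σ x) (σ y) := by
  classical
  choose X Y hXY hadj using h2
  have hnext : ∀ a u, ∃ b, S.Adj u a → b ≠ a ∧ ∀ z, S.Adj u z ↔ z = a ∨ z = b := by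
    intro a u
    by_cases ha : S.Adj u a
    · rcases (hadj u a).1 ha with rfl | rfl
      · exact ⟨Y u, fun _ => ⟨(hXY u).symm, hadj u⟩⟩
      · exact ⟨X u, fun _ => ⟨hXY u, fun z => by rw [hadj u, or_comm]⟩⟩
    · exact ⟨a, fun h => absurd h ha⟩
  choose nx hnx using hnext
  obtain ⟨u₀⟩ := ‹Nonempty V›
  -- A walk that never turns back, stored as pairs of consecutive vertices. Its first repetition
  -- returns to the start, and the resulting closed cycle is everything by connectedness.
  let q : ℕ → V × V := fun k => Nat.rec (u₀, X u₀) (fun _ r => (r.2, nx r.1 r.2)) k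
  let p : ℕ → V := fun k => (q k).1
  have hq : ∀ k, q (k + 1) = ((q k).2, nx (q k).1 (q k).2) := fun _ => rfl
  have hp1 : ∀ k, S.Adj (q k).1 (q k).2 := by
    intro k
    induction k with
    | zero => exact (hadj u₀ _).2 (Or.inl rfl)
    | succ k ih =>
      rw [hq]
      exact ((hnx _ _ ih.symm).2 _).2 (Or.inr rfl)
  have hadjp : ∀ k, S.Adj (p k) (p (k + 1)) := hp1
  have hne : ∀ k, p (k + 2) ≠ p k := fun k => (hnx _ _ (hp1 k).symm).1
  have hnb : ∀ k z, S.Adj (p (k + 1)) z ↔ z = p k ∨ z = p (k + 2) :=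
    fun k => (hnx _ _ (hp1 k).symm).2
  have hex : ∃ n, ∃ i < n, p i = p n := by
    obtain ⟨i, j, hij, h⟩ := Finite.exists_ne_map_eq_of_infinite p
    rcases lt_or_gt_of_ne hij with hlt | hlt
    · exact ⟨j, i, hlt, h⟩
    · exact ⟨i, j, hlt, h.symm⟩
  obtain ⟨n, ⟨i, hin, hi⟩, hmin⟩ : ∃ n, (∃ i < n, p i = p n) ∧ ∀ m < n, ¬ ∃ i < m, p i = p m :=
    ⟨Nat.find hex, Nat.find_spec hex, fun m hm => Nat.find_min hex hm⟩
  have hinj : ∀ a < n, ∀ b < n, p a = p b → a = b := by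
    intro a ha b hb hab
    rcases lt_trichotomy a b with h | h | h
    · exact absurd ⟨a, h, hab⟩ (hmin b hb)
    · exact h
    · exact absurd ⟨b, h, hab.symm⟩ (hmin a ha)
  have hn1 : n ≠ i + 1 := by
    rintro rfl
    exact (hadjp i).ne hi
  have hn2 : n ≠ i + 2 := by
    rintro rfl
    exact hne i hi.symm
  have hlast : S.Adj (p n) (p (n - 1)) := by
    have := hadjp (n - 1)
    rw [Nat.sub_add_cancel (by omega)] at this
    exact this.symm
  -- At an inner vertex both neighbors are already known on the walk, so returning there would
  -- repeat a vertex earlier.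
  have hi0 : i = 0 := by
    by_contra h0
    obtain ⟨k, rfl⟩ := Nat.exists_eq_succ_of_ne_zero h0
    rw [← hi] at hlast
    rcases (hnb k _).1 hlast with h | h
    · have := hinj (n - 1) (by omega) k (by omega) h
      omega
    · have := hinj (n - 1) (by omega) (k + 2) (by omega) h
      omega
  subst hi0
  have hnb0 : ∀ z, S.Adj (p 0) z ↔ z = p 1 ∨ z = p (n - 1) := by
    have h1 : p (n - 1) ≠ p 1 := fun h => by
      have := hinj (n - 1) (by omega) 1 (by omega) h
      omega
    rw [← hi] at hlast
    have h2 := hadjp 0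
    intro z
    rw [hnx _ _ h2 |>.2] at hlast ⊢
    rw [hlast.resolve_left h1]
    exact Iff.rfl
  have hrange : p '' {k | k < n} = univ := by
    refine hconn _ ⟨p 0, 0, by simp only [mem_ofPred_eq]; omega, rfl⟩ ?_
    rintro _ ⟨k, hk, rfl⟩ z hz
    simp only [mem_ofPred_eq] at hk
    rcases k with _ | k
    · rcases (hnb0 z).1 hz with rfl | rfl
      · exact ⟨1, by simp only [mem_ofPred_eq]; omega, rfl⟩
      · exact ⟨n - 1, by simp only [mem_ofPred_eq]; omega, rfl⟩
    · rcases (hnb k z).1 hz with rfl | rfl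
      · exact ⟨k, by simp only [mem_ofPred_eq]; omega, rfl⟩
      · rcases Nat.lt_or_ge (k + 2) n with h | h
        · exact ⟨k + 2, h, rfl⟩
        · have : k + 2 = n := by omega
          exact ⟨0, by simp only [mem_ofPred_eq]; omega, by rw [hi, this]⟩
  have hbij : Bijective (fun k : Fin n => p k) := by
    refine ⟨fun a b hab => Fin.ext (hinj _ a.2 _ b.2 hab), fun z => ?_⟩
    obtain ⟨k, hk, rfl⟩ := (hrange ▸ mem_univ z : z ∈ p '' {k | k < n})
    exact ⟨⟨k, hk⟩, rfl⟩
  have hn3 : 3 ≤ n := by omega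
  let τ : Fin n ≃ V := Equiv.ofBijective _ hbij
  have hτ : ∀ a b : Fin n, S.Adj (τ a) (τ b) ↔ (SimpleGraph.cycleGraph n).Adj a b := by
    rintro ⟨a, ha⟩ ⟨b, hb⟩
    rw [cycleGraph_adj_iff hn3]
    change S.Adj (p a) (p b) ↔ _
    simp only
    have hiff : ∀ k < n, p b = p k ↔ b = k := fun k hk => ⟨hinj b hb k hk, fun h => h ▸ rfl⟩
    rcases a with _ | a
    · rw [hnb0, hiff 1 (by omega), hiff (n - 1) (by omega)]
      omega
    · rw [hnb, hiff a (by omega)]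
      rcases Nat.lt_or_ge (a + 2) n with h | h
      · rw [hiff _ h]
        omega
      · have : a + 2 = n := by omega
        rw [this, ← hi, hiff 0 (by omega)]
        omega
  exact ⟨n, hn3, τ.symm, fun x y => by rw [← hτ]; simp⟩

/-- A connected hypergraph without separating vertex that has a bad cover is a DP-hyperbrick. -/
theorem isDPHyperbrick_of_isBad [Finite V] [Finite E] [Nonempty V] (hconn : G.ConnOn univ univ)
    (hsep : ∀ x, G.ConnOn {x}ᶜ univ) (hbad : G.IsBad univ univ) : G.IsDPHyperbrick := by
  by_cases h3 : ∃ e, 2 < (G.inc e).ncard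
  · obtain ⟨e, he⟩ := h3
    exact Or.inr ⟨e, isSingleEdge_of_isBad hconn hsep hbad he⟩
  left
  push Not at h3
  have h2 : ∀ e, (G.inc e).ncard = 2 := fun e =>
    le_antisymm (h3 e) (one_lt_ncard_iff_nontrivial.2 (G.inc_nontrivial e))
  obtain ⟨L, M, hM, hdeg, hunc⟩ := hbad
  have hinc : ∀ e, ∃ x y, G.inc e = {x, y} ∧ x ≠ y := fun e => by
    obtain ⟨x, y, hxy, h⟩ := ncard_eq_two.1 (h2 e)
    exact ⟨x, y, h, hxy⟩
  have hnbr : ∀ x y : V, x ≠ y → ∃ e z, G.inc e = {x, z} := by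
    intro x y hxy
    obtain ⟨e, -, ⟨z, hz, hzx⟩, ⟨z', hz', hzx'⟩⟩ := hconn {x} (subset_univ _) (singleton_nonempty x)
      ⟨y, mem_univ _, hxy.symm⟩
    obtain rfl := mem_singleton_iff.1 hzx
    exact ⟨e, z', inc_eq_pair h2 hz hz' (by rintro rfl; exact hzx'.2 rfl)⟩
  have hK : ∀ u, (∀ w ≠ u, G.ConnOn ({u}ᶜ \ {w}) univ) → ∀ x ≠ u, ∀ y ≠ u,
      G.mult univ u x = G.mult univ u y := fun u hu x hx y hy =>
    mult_eq_of_connOn h2 hM hdeg hunc hconn hsep hu hx hy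
  by_cases hall : ∀ u, ∀ w ≠ u, G.ConnOn ({u}ᶜ \ {w}) univ
  · left
    have hn : 1 ≤ Nat.card V := Nat.card_pos
    obtain ⟨t, ht, hmult⟩ : ∃ t, 1 ≤ t ∧ ∀ x y, x ≠ y → G.mult univ x y = t := by
      by_cases hV : ∃ x₀ y₀ : V, x₀ ≠ y₀
      · obtain ⟨x₀, y₀, hxy₀⟩ := hV
        refine ⟨G.mult univ x₀ y₀, ?_, fun x y hxy => ?_⟩
        · obtain ⟨e, z, he⟩ := hnbr x₀ y₀ hxy₀
          rw [hK x₀ (hall x₀) y₀ hxy₀.symm z (ne_of_inc_eq he).symm]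
          exact mult_pos he
        · by_cases hx : x = x₀
          · subst hx; exact hK x (hall x) y hxy.symm y₀ hxy₀.symm
          · rw [hK x (hall x) y hxy.symm x₀ (Ne.symm hx), mult_comm,
              hK x₀ (hall x₀) x hx y₀ hxy₀.symm]
      -- With a single vertex there are no pairs, and any `t ≥ 1` will do.
      · exact ⟨1, le_rfl, fun x y hxy => absurd ⟨x, y, hxy⟩ hV⟩
    refine ⟨t, Nat.card V, ht, hn, nonempty_iso_multiple (Finite.equivFin V) _ (fun e => ?_)
      (fun x y hxy => hmult x y ?_)⟩
    · obtain ⟨x, y, h, hxy⟩ := hinc e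
      exact ⟨x, y, h, by simpa [SimpleGraph.completeGraph] using hxy⟩
    · rintro rfl; exact hxy.ne rfl
  · right
    push Not at hall
    obtain ⟨u₀, w₀, hw₀, hu₀⟩ := hall
    have hC : ∀ u, ∃ x y, x ≠ y ∧ (∃ e, G.inc e = {x, u}) ∧ (∃ e, G.inc e = {y, u}) ∧
        (¬ ∃ e, G.inc e = {x, y}) ∧ ∀ z, (∃ e, G.inc e = {z, u}) → z = x ∨ z = y := by
      intro u
      by_cases hu : ∀ w ≠ u, G.ConnOn ({u}ᶜ \ {w}) univ
      -- If `G - u` had no separating vertex, `u` would be adjacent to all other vertices. It would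
      -- then be one of the two neighbors of `u₀` and adjacent to the other, but those two are
      -- nonadjacent.
      · exfalso
        have huu : u₀ ≠ u := by rintro rfl; exact hu₀ (hu w₀ hw₀)
        have hall' : ∀ z ≠ u, ∃ e, G.inc e = {u, z} := by
          intro z hz
          obtain ⟨e, z', he⟩ := hnbr u z hz.symm
          have := mult_pos he
          rw [hK u hu z' (ne_of_inc_eq he).symm z hz] at this
          obtain ⟨e', -, he'⟩ := exists_of_mult_pos this
          exact ⟨e', he'⟩
        obtain ⟨x, y, hxy, -, -, hnadj, hz⟩ := exists_two_neighbors h2 hM hdeg hunc hsep hw₀ hu₀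
        rcases hz u (hall' u₀ huu) with rfl | rfl
        · exact hnadj (hall' y hxy.symm)
        · obtain ⟨e, he⟩ := hall' x hxy
          exact hnadj ⟨e, by rw [he, pair_comm]⟩
      · push Not at hu
        obtain ⟨w, hw, h⟩ := hu
        exact exists_two_neighbors h2 hM hdeg hunc hsep hw h
    have hsymm : ∀ x y, (∃ e, G.inc e = {x, y}) → ∃ e, G.inc e = {y, x} := by
      rintro x y ⟨e, he⟩
      exact ⟨e, by rw [he, pair_comm]⟩
    let S : SimpleGraph V := SimpleGraph.fromRel fun x y => ∃ e, G.inc e = {x, y}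
    have hS : ∀ x y, S.Adj x y ↔ ∃ e, G.inc e = {x, y} := by
      intro x y
      simp only [S, SimpleGraph.fromRel_adj]
      constructor
      · rintro ⟨-, h | h⟩
        · exact h
        · exact hsymm _ _ h
      · rintro ⟨e, h⟩
        exact ⟨ne_of_inc_eq h, Or.inl ⟨e, h⟩⟩
    have hSconn : ∀ Q : Set V, Q.Nonempty → (∀ x ∈ Q, ∀ y, S.Adj x y → y ∈ Q) → Q = univ := by
      intro Q hQ hcl
      by_contra hne
      obtain ⟨e, -, ⟨z, hz, hzQ⟩, ⟨z', hz', hzQ'⟩⟩ := hconn Q (subset_univ _) hQ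
        (by rw [← compl_eq_univ_sdiff]; exact nonempty_compl.2 hne)
      exact hzQ'.2 (hcl z hzQ z' ((hS _ _).2 ⟨e, inc_eq_pair h2 hz hz'
        (by rintro rfl; exact hzQ'.2 hzQ)⟩))
    have hm : ∀ u x y, S.Adj x u → S.Adj y u → G.mult univ x u = G.mult univ y u := by
      intro u x y hx hy
      rw [hS] at hx hy
      by_cases hxy : x = y
      · rw [hxy]
      obtain ⟨x', y', hxy', hx', hy', -, hz⟩ := hC u
      have hz' : ∀ z, (∃ e, G.inc e = {z, u}) → z = x ∨ z = y := by
        intro z h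
        have h1 := hz z h
        have h3 := hz x hx
        have h4 := hz y hy
        grind
      exact le_antisymm
        (mult_le_of_two_neighbors h2 hM hdeg hunc hconn hsep (Ne.symm hxy) hy hx
          fun z h => (hz' z h).symm)
        (mult_le_of_two_neighbors h2 hM hdeg hunc hconn hsep hxy hx hy hz')
    obtain ⟨n, hn, σ, hσ⟩ := exists_equiv_cycleGraph S hSconn (fun u => by
      obtain ⟨x, y, hxy, hx, hy, -, hz⟩ := hC u
      refine ⟨x, y, hxy, fun z => ?_⟩
      rw [S.adj_comm, hS]
      exact ⟨hz z, by rintro (rfl | rfl) <;> assumption⟩)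
    obtain ⟨x₀, -, -, hx₀, -⟩ := hC u₀
    have huniv : {u | ∀ z, S.Adj z u → G.mult univ z u = G.mult univ x₀ u₀} = univ := by
      refine hSconn _ ⟨u₀, fun z hz => hm u₀ z x₀ hz ((hS _ _).2 hx₀)⟩ fun u hu y huy z hz => ?_
      rw [hm y z u hz huy, mult_comm]
      exact hu y huy.symm
    refine ⟨G.mult univ x₀ u₀, n, ?_, hn, nonempty_iso_multiple σ _ (fun e => ?_) (fun x y hxy => ?_)⟩
    · obtain ⟨e, he⟩ := hx₀
      exact mult_pos he
    · obtain ⟨x, y, h, -⟩ := hinc e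
      exact ⟨x, y, h, (hσ x y).1 ((hS x y).2 ⟨e, h⟩)⟩
    · exact (huniv ▸ mem_univ y : y ∈ {u | ∀ z, S.Adj z u → G.mult univ z u = G.mult univ x₀ u₀}) x
        ((hσ x y).2 hxy)

end Brick

/-! ### Translation of connectedness, separation and covers -/

section Conversion

variable {V : Type u} {E : Type v} {G : MultiHypergraph V E}

/-- The vertices at distance at most `n` from `x`. -/
def layer (G : MultiHypergraph V E) (x : V) : ℕ → Set V
  | 0 => {x}
  | n + 1 => {y | ∃ z ∈ layer G x n, ∃ e, z ∈ G.inc e ∧ y ∈ G.inc e}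

/-- Recording that the `i`-th vertex has distance exactly `i` makes the vertices and edges of a
shortest path distinct in `isConnected_iff`. -/
lemma exists_hyperpath_of_layer {x : V} : ∀ (n : ℕ) (y : V), y ∈ G.layer x n →
    (∀ m < n, y ∉ G.layer x m) → ∃ (p : Fin (n + 1) → V) (f : Fin n → E),
      (∀ i : Fin (n + 1), p i ∈ G.layer x i ∧ ∀ m < (i : ℕ), p i ∉ G.layer x m) ∧ p (Fin.last n) = y ∧
        ∀ i : Fin n, p i.castSucc ∈ G.inc (f i) ∧ p i.succ ∈ G.inc (f i)
  | 0, y, hy, _ => ⟨fun _ => y, Fin.elim0, fun i => by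
      rw [Fin.fin_one_eq_zero i]; exact ⟨hy, by simp⟩, rfl, fun i => i.elim0⟩
  | n + 1, y, hy, hmin => by
    obtain ⟨z, hz, e, hze, hye⟩ := hy
    obtain ⟨p, f, hp, hlast, hf⟩ := exists_hyperpath_of_layer n z hz
      (fun m hm hzm => hmin (m + 1) (by omega) ⟨z, hzm, e, hze, hye⟩)
    refine ⟨Fin.snoc (α := fun _ => V) p y, Fin.snoc (α := fun _ => E) f e, ?_, by simp, ?_⟩
    · intro i
      induction i using Fin.lastCases with
      | last =>
        rw [Fin.snoc_last]
        exact ⟨⟨z, hz, e, hze, hye⟩, hmin⟩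
      | cast i => simpa using hp i
    · intro i
      induction i using Fin.lastCases with
      | last =>
        rw [Fin.succ_last]
        simpa [hlast] using ⟨hze, hye⟩
      | cast i =>
        rw [Fin.succ_castSucc, Fin.snoc_castSucc, Fin.snoc_castSucc, Fin.snoc_castSucc]
        exact hf i

theorem isConnected_iff : G.IsConnected ↔ G.ConnOn univ univ := by
  constructor
  · rintro h Q - ⟨x, hx⟩ ⟨y, -, hy⟩
    obtain ⟨q, p, f, -, -, rfl, rfl, hf⟩ := h x y
    by_contra! hcon
    have hall : ∀ i, p i ∈ Q := by
      intro i
      induction i using Fin.induction with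
      | zero => exact hx
      | succ i ih =>
        by_contra hi
        have : p i.succ ∈ G.inc (f i) ∩ (univ \ Q) := ⟨(hf i).2, mem_univ _, hi⟩
        rw [hcon (f i) (mem_univ _) ⟨_, (hf i).1, ih⟩] at this
        exact this
    exact hy (hall _)
  · intro h x y
    have hreach : ∃ n, y ∈ G.layer x n := by
      by_contra hy
      obtain ⟨e, -, ⟨z, hze, n, hz⟩, ⟨z', hze', -, hz'⟩⟩ := h {z | ∃ n, z ∈ G.layer x n}
        (subset_univ _) ⟨x, 0, rfl⟩ ⟨y, mem_univ _, hy⟩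
      exact hz' ⟨n + 1, z, hz, e, hze, hze'⟩
    classical
    obtain ⟨p, f, hp, hlast, hf⟩ := exists_hyperpath_of_layer (Nat.find hreach) y
      (Nat.find_spec hreach) (fun m hm => Nat.find_min hreach hm)
    have hpinj : ∀ i j : Fin (Nat.find hreach + 1), (i : ℕ) < j → p i ≠ p j := fun i j hij h =>
      (hp j).2 i hij (h ▸ (hp i).1)
    -- A repeated edge would be a shortcut: it would put `p (j + 1)` at distance at most `i + 1`.
    have hfinj : ∀ i j : Fin (Nat.find hreach), (i : ℕ) < j → f i ≠ f j := fun i j hij h =>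
      (hp j.succ).2 (i + 1) (by simpa using hij) ⟨_, (hp i.castSucc).1, f i, (hf i).1,
        h ▸ (hf j).2⟩
    refine ⟨_, p, f, fun i j hij => ?_, fun i j hij => ?_, (hp 0).1, hlast, hf⟩
    · rcases lt_trichotomy (i : ℕ) j with h | h | h
      · exact absurd hij (hpinj i j h)
      · exact Fin.ext h
      · exact absurd hij.symm (hpinj j i h)
    · rcases lt_trichotomy (i : ℕ) j with h | h | h
      · exact absurd hij (hfinj i j h)
      · exact Fin.ext h
      · exact absurd hij.symm (hfinj j i h)

theorem not_isSeparating_iff {x : V} : ¬ G.IsSeparating x ↔ G.ConnOn {x}ᶜ univ := by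
  constructor
  · intro h Q hQ hne hne'
    by_contra! hcon
    obtain ⟨y, hy⟩ := hne
    obtain ⟨z, hzx, hz⟩ := hne'
    have hxQ : x ∉ Q := fun h => hQ h rfl
    refine h ⟨insert x Q, Qᶜ, ?_, ⟨x, mem_insert x Q, y, mem_insert_of_mem x hy,
      fun h => hxQ (h ▸ hy)⟩, ⟨x, hxQ, z, hz, fun h => hzx h.symm⟩, ?_, ?_⟩
    · ext t
      simp only [mem_inter_iff, mem_insert_iff, mem_compl_iff, mem_singleton_iff]
      constructor
      · rintro ⟨rfl | h, h'⟩
        · rfl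
        · exact absurd h h'
      · rintro rfl
        exact ⟨Or.inl rfl, hxQ⟩
    · refine eq_univ_of_forall fun t => ?_
      by_cases ht : t ∈ Q
      · exact Or.inl (mem_insert_of_mem x ht)
      · exact Or.inr ht
    · refine eq_univ_of_forall fun e => ?_
      by_cases heQ : (G.inc e ∩ Q).Nonempty
      · left
        intro t ht
        by_contra htQ
        simp only [mem_insert_iff, not_or] at htQ
        have : t ∈ G.inc e ∩ ({x}ᶜ \ Q) := ⟨ht, htQ.1, htQ.2⟩
        rw [hcon e (mem_univ e) heQ] at this
        exact this
      · exact Or.inr fun t ht htQ => heQ ⟨t, ht, htQ⟩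
  · rintro h ⟨S, T, hST, hS, hT, hverts, hedges⟩
    have hmem : ∀ z, z ∈ S → z ∈ T → z = x := fun z h1 h2 => by
      have : z ∈ S ∩ T := ⟨h1, h2⟩
      rwa [hST] at this
    obtain ⟨y, hy, hyx⟩ := hS.exists_ne x
    obtain ⟨z, hz, hzx⟩ := hT.exists_ne x
    obtain ⟨e, -, ⟨t, hte, htS, htx⟩, ⟨t', hte', htx', ht'⟩⟩ := h (S \ {x}) (fun _ h => h.2)
      ⟨y, hy, hyx⟩ ⟨z, hzx, fun h => hzx (hmem z h.1 hz)⟩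
    rcases (hedges ▸ mem_univ e : e ∈ (G.induce S).edges ∪ (G.induce T).edges) with he | he
    · exact ht' ⟨he hte', htx'⟩
    · exact htx (hmem t htS (he hte))

theorem Sub.connOn_coe_iff {A : G.Sub} {S : Set A.verts} :
    A.coe.ConnOn S univ ↔ G.ConnOn (Subtype.val '' S) A.edges := by
  constructor
  · intro h Q hQ hne hne'
    obtain ⟨x, hx⟩ := hne
    obtain ⟨x, hxS, rfl⟩ := hQ hx
    obtain ⟨_, ⟨y, hyS, rfl⟩, hy⟩ := hne'
    obtain ⟨e, -, ⟨z, hze, hzQ⟩, ⟨z', hze', hzS', hzQ'⟩⟩ := h (Subtype.val ⁻¹' Q) (fun z hz => by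
        obtain ⟨z', hz', h⟩ := hQ hz
        rwa [Subtype.ext h] at hz') ⟨x, hx⟩ ⟨y, hyS, hy⟩
    exact ⟨e, e.2, ⟨z, hze, hzQ⟩, ⟨z', hze', ⟨z', hzS', rfl⟩, hzQ'⟩⟩
  · rintro h Q hQ ⟨x, hx⟩ ⟨y, hyS, hy⟩
    obtain ⟨e, he, ⟨_, hze, z, hzQ, rfl⟩, ⟨_, hze', ⟨z', hzS', rfl⟩, hzQ'⟩⟩ :=
      h (Subtype.val '' Q) (image_mono hQ) ⟨x, x, hx, rfl⟩
        ⟨y, ⟨y, hyS, rfl⟩, by rwa [Subtype.val_injective.mem_set_image]⟩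
    rw [Subtype.val_injective.mem_set_image] at hzQ'
    exact ⟨⟨e, he⟩, mem_univ _, ⟨z, hze, hzQ⟩, ⟨z', hze', hzS', hzQ'⟩⟩

/-- No vertex of the subhypergraph with vertices `R` and edges `F` separates it. -/
def NonsepOn (G : MultiHypergraph V E) (R : Set V) (F : Set E) : Prop :=
  ∀ x ∈ R, G.ConnOn (R \ {x}) F

lemma Sub.image_univ (A : G.Sub) : (Subtype.val '' (univ : Set A.verts)) = A.verts := by
  simp

lemma Sub.image_compl (A : G.Sub) (x : A.verts) :
    (Subtype.val '' ({x}ᶜ : Set A.verts)) = A.verts \ {(x : V)} := by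
  rw [compl_eq_univ_sdiff, image_sdiff Subtype.val_injective]
  simp

theorem Sub.isConnected_coe_iff {A : G.Sub} : A.coe.IsConnected ↔ G.ConnOn A.verts A.edges := by
  rw [isConnected_iff, Sub.connOn_coe_iff, Sub.image_univ]

theorem Sub.not_isSeparating_coe_iff {A : G.Sub} :
    (∀ x, ¬ A.coe.IsSeparating x) ↔ G.NonsepOn A.verts A.edges := by
  simp only [not_isSeparating_iff, Sub.connOn_coe_iff, Sub.image_compl, NonsepOn]
  exact ⟨fun h x hx => h ⟨x, hx⟩, fun h x => h x x.2⟩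

lemma Sub.degOn_coe {A : G.Sub} (x : A.verts) : A.coe.degOn univ x = G.degOn A.edges x := by
  unfold degOn
  rw [← ncard_image_of_injective _ (Subtype.val_injective (p := (· ∈ A.edges)))]
  congr 1
  ext e
  constructor
  · rintro ⟨e, ⟨-, hx⟩, rfl⟩
    exact ⟨e.2, hx⟩
  · rintro ⟨he, hx⟩
    exact ⟨⟨e, he⟩, ⟨mem_univ _, hx⟩, rfl⟩

theorem IsBad.coe {A : G.Sub} (h : G.IsBad A.verts A.edges) : A.coe.IsBad univ univ := by
  classical
  obtain ⟨L, M, hM, hdeg, hunc⟩ := h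
  refine ⟨fun x => L x, fun e => {φ | ∃ ψ ∈ M e, φ = fun x : A.verts => ψ x}, ?_, ?_, ?_⟩
  · rintro e _ ⟨φ, hφ, rfl⟩ _ ⟨ψ, hψ, rfl⟩ x hx hxx y hy
    exact hM e φ hφ ψ hψ x hx hxx hy
  · intro x _
    rw [Sub.degOn_coe]
    exact hdeg x x.2
  · intro c hc
    obtain ⟨e, he, φ, hφ, hcφ⟩ := hunc (fun x => if h : x ∈ A.verts then c ⟨x, h⟩ else 0)
      (fun x hx => by simpa [hx] using hc ⟨x, hx⟩ (mem_univ _))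
    refine ⟨⟨e, he⟩, mem_univ _, _, ⟨φ, hφ, rfl⟩, fun x hx => ?_⟩
    simpa using hcφ hx

lemma Iso.mem_inc_iff {V' : Type u'} {E' : Type v'} {G' : MultiHypergraph V' E'} (σ : G.Iso G')
    (e : E) (x : V) : σ.vertEquiv x ∈ G'.inc (σ.edgeEquiv e) ↔ x ∈ G.inc e := by
  rw [σ.inc_edgeEquiv, σ.vertEquiv.injective.mem_set_image]

lemma Iso.degOn_eq {V' : Type u'} {E' : Type v'} {G' : MultiHypergraph V' E'} (σ : G.Iso G')
    (x : V) : G.degOn univ x = G'.degOn univ (σ.vertEquiv x) := by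
  unfold degOn
  rw [← ncard_image_of_injective _ σ.edgeEquiv.injective]
  congr 1
  ext e
  obtain ⟨e, rfl⟩ := σ.edgeEquiv.surjective e
  rw [σ.edgeEquiv.injective.mem_set_image]
  simp [σ.mem_inc_iff]

theorem IsBad.of_iso {V' : Type u'} {E' : Type v'} {G' : MultiHypergraph V' E'} {A : G.Sub}
    (σ : A.coe.Iso G') (h : G'.IsBad univ univ) : G.IsBad A.verts A.edges := by
  classical
  obtain ⟨L, M, hM, hdeg, hunc⟩ := h
  refine ⟨fun x => if h : x ∈ A.verts then L (σ.vertEquiv ⟨x, h⟩) else ∅,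
    fun e => {φ | ∃ h : e ∈ A.edges, ∃ ψ ∈ M (σ.edgeEquiv ⟨e, h⟩),
      ∀ x : A.verts, φ x = ψ (σ.vertEquiv x)}, ?_, ?_, ?_⟩
  · rintro e φ ⟨he, φ', hφ', hφ⟩ ψ ⟨_, ψ', hψ', hψ⟩ x hx hxx y hy
    have hx' := A.inc_subset e he hx
    have hy' := A.inc_subset e he hy
    rw [hφ ⟨x, hx'⟩, hψ ⟨x, hx'⟩] at hxx
    rw [hφ ⟨y, hy'⟩, hψ ⟨y, hy'⟩]
    exact hM _ φ' hφ' ψ' hψ' _ ((σ.mem_inc_iff ⟨e, he⟩ ⟨x, hx'⟩).2 hx) hxx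
      ((σ.mem_inc_iff ⟨e, he⟩ ⟨y, hy'⟩).2 hy)
  · intro x hx
    beta_reduce
    rw [dif_pos hx, ← Sub.degOn_coe (A := A) ⟨x, hx⟩, σ.degOn_eq]
    exact hdeg _ (mem_univ _)
  · intro c hc
    obtain ⟨e, -, φ, hφ, hcφ⟩ := hunc (fun y => c (σ.vertEquiv.symm y)) (fun y _ => by
      have := hc _ (σ.vertEquiv.symm y).2
      beta_reduce at this
      rw [dif_pos (σ.vertEquiv.symm y).2] at this
      simpa using this)
    obtain ⟨⟨e, he⟩, rfl⟩ := σ.edgeEquiv.surjective e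
    refine ⟨e, he, fun x => if h : x ∈ A.verts then φ (σ.vertEquiv ⟨x, h⟩) else 0,
      ⟨he, φ, hφ, fun x => by simp⟩, fun x hx => ?_⟩
    have hx' := A.inc_subset e he hx
    have := hcφ ((σ.mem_inc_iff ⟨e, he⟩ ⟨x, hx'⟩).2 hx)
    simp only [Equiv.symm_apply_apply] at this
    simp [hx', this]

lemma isBad_of_not_isDPDegreeColorable [Finite V] [Finite E]
    (h : ¬ MultiHypergraph.IsDPDegreeColorable.{u, v, w} G) : G.IsBad univ univ := by
  classical
  unfold IsDPDegreeColorable at h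
  push Not at h
  obtain ⟨W, F, _, _, X, H, hcov, hdeg, hnot⟩ := h
  obtain ⟨N, hN, hNuniv⟩ := hcov.exists_matching
  obtain ⟨ι, hι⟩ : ∃ ι : W → ℕ, Injective ι :=
    ⟨fun w => Finite.equivFin W w, Fin.val_injective.comp (Finite.equivFin W).injective⟩
  refine ⟨fun x => (toFinite (X x)).toFinset.image ι, fun e => {φ | ∃ f ∈ N e, ∃ ψ : V → W,
    (∀ x ∈ G.inc e, ψ x ∈ H.inc f ∩ X x) ∧ φ = ι ∘ ψ}, ?_, ?_, ?_⟩
  · rintro e _ ⟨f, hf, φ, hφ, rfl⟩ _ ⟨f', hf', ψ, hψ, rfl⟩ x hx hxx y hy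
    have hxx' : φ x = ψ x := hι hxx
    have hff : f = f' := (hN e).2.1 (φ x) f hf f' hf' (hφ x hx).1 (hxx' ▸ (hψ x hx).1)
    subst hff
    obtain ⟨w, hw⟩ := ncard_eq_one.1 ((hN e).2.2 f hf y hy)
    have h1 := hφ y hy
    have h2 := hψ y hy
    rw [hw] at h1 h2
    exact congrArg ι (h1.trans h2.symm)
  · intro x _
    rw [Finset.card_image_of_injective _ hι, ← ncard_eq_toFinset_card]
    refine le_trans (le_of_eq ?_) (hdeg x)
    simp [degOn, degree]
  · intro c hc
    have hc' : ∀ x, ∃ w ∈ X x, ι w = c x := fun x => by simpa using hc x (mem_univ x)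
    choose d hd hdc using hc'
    have hdX : ∀ x z, d z ∈ X x → z = x := fun x z hz => by
      by_contra hzx
      exact (hcov.disjoint z x hzx).notMem_of_mem_left (hd z) hz
    have hT : ¬ H.IsIndependent (range d) := fun hT => hnot ⟨range d, fun x => by
      rw [ncard_eq_one]
      refine ⟨d x, ?_⟩
      ext w
      constructor
      · rintro ⟨⟨z, rfl⟩, hz⟩
        rw [hdX x z hz]; rfl
      · rintro rfl
        exact ⟨⟨x, rfl⟩, hd x⟩, hT⟩
    obtain ⟨f, hf⟩ := nonempty_iff_ne_empty.2 hT
    obtain ⟨e, he⟩ := mem_iUnion.1 (hNuniv ▸ mem_univ f : f ∈ ⋃ e, N e)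
    refine ⟨e, mem_univ _, ι ∘ d, ⟨f, he, d, fun x hx => ⟨?_, hd x⟩, rfl⟩, fun x _ => (hdc x).symm⟩
    obtain ⟨w, hw⟩ := ncard_eq_one.1 ((hN e).2.2 f he x hx)
    have hwf : w ∈ H.inc f ∩ X x := by rw [hw]; rfl
    obtain ⟨z, rfl⟩ := hf hwf.1
    rw [← hdX x z hwf.2]
    exact hwf.1

lemma not_isDPDegreeColorable_of_isBad [Finite V] [Finite E] (h : G.IsBad univ univ) :
    ¬ MultiHypergraph.IsDPDegreeColorable.{u, v, w} G := by
  classical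
  obtain ⟨L, M, hM, hdeg, hunc⟩ := h
  let W := {q : V × ℕ // q.2 ∈ L q.1}
  have : Finite W := Finite.of_injective (β := Σ x : V, {a // a ∈ L x})
    (fun q => ⟨q.1.1, q.1.2, q.2⟩) fun q r h => by
      simp only [Sigma.mk.injEq] at h
      obtain ⟨h1, h2⟩ := h
      exact Subtype.ext (Prod.ext h1 ((Subtype.heq_iff_coe_eq (by simp [h1])).1 h2))
  let colors : E → (V → ℕ) → Set W := fun e φ => {w | w.1.1 ∈ G.inc e ∧ w.1.2 = φ w.1.1}
  -- An edge of `H` records the set of colors, not the function `φ`: functions agreeing on the edge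
  -- must give the same edge, for finiteness and for the matching property. Copies of `Fin` then
  -- place vertices and edges in the required universe.
  let F := {p : E × Set W // ∃ φ ∈ M p.1, (∀ x ∈ G.inc p.1, φ x ∈ L x) ∧ p.2 = colors p.1 φ}
  let α : ULift.{w} (Fin (Nat.card W)) ≃ W := Equiv.ulift.trans (Finite.equivFin W).symm
  let β : ULift.{w} (Fin (Nat.card F)) ≃ F := Equiv.ulift.trans (Finite.equivFin F).symm
  have hβ : ∀ f, ∃ φ ∈ M (β f).1.1, (∀ x ∈ G.inc (β f).1.1, φ x ∈ L x) ∧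
      (β f).1.2 = colors (β f).1.1 φ := fun f => (β f).2
  have hmk : ∀ x a (ha : a ∈ L x), ∃ w, α w = ⟨(x, a), ha⟩ := fun x a ha => α.surjective _
  let H : MultiHypergraph (ULift.{w} (Fin (Nat.card W))) (ULift.{w} (Fin (Nat.card F))) :=
    { inc := fun f => {w | α w ∈ (β f).1.2}
      inc_nontrivial := fun f => by
        obtain ⟨φ, -, hφL, hφ⟩ := hβ f
        obtain ⟨x, hx, y, hy, hxy⟩ := G.inc_nontrivial (β f).1.1
        obtain ⟨w, hw⟩ := hmk x _ (hφL x hx)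
        obtain ⟨w', hw'⟩ := hmk y _ (hφL y hy)
        refine ⟨w, ?_, w', ?_, ?_⟩
        · rw [mem_ofPred_eq, hφ, hw]
          exact ⟨hx, rfl⟩
        · rw [mem_ofPred_eq, hφ, hw']
          exact ⟨hy, rfl⟩
        · rintro rfl
          rw [hw] at hw'
          exact hxy (congrArg (fun q : W => q.1.1) hw') }
  have hH : ∀ f w, w ∈ H.inc f ↔ α w ∈ (β f).1.2 := fun f w => Iff.rfl
  let X : V → Set (ULift.{w} (Fin (Nat.card W))) := fun x => {w | (α w).1.1 = x}
  have hX : ∀ x w, w ∈ X x ↔ (α w).1.1 = x := fun x w => Iff.rfl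
  have hcov : G.IsCover X H := by
    refine ⟨fun x y hxy => disjoint_left.2 fun w hx hy => hxy (hx.symm.trans hy),
      eq_univ_of_forall fun w => mem_iUnion.2 ⟨_, rfl⟩, fun x => ?_, fun e => {f | (β f).1.1 = e},
      ?_, eq_univ_of_forall fun f => mem_iUnion.2 ⟨_, rfl⟩⟩
    · refine eq_empty_of_forall_notMem fun f hf => ?_
      obtain ⟨φ, -, hφL, hφ⟩ := hβ f
      obtain ⟨y, hy, hyx⟩ := (G.inc_nontrivial (β f).1.1).exists_ne x
      obtain ⟨w, hw⟩ := hmk y _ (hφL y hy)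
      have hwf : w ∈ H.inc f := by
        rw [hH, hφ, hw]
        exact ⟨hy, rfl⟩
      have := (hX x w).1 (hf hwf)
      rw [hw] at this
      exact hyx this
    · intro e
      refine ⟨?_, ?_, ?_⟩
      · rintro f rfl w hw
        obtain ⟨φ, -, hφL, hφ⟩ := hβ f
        rw [hH, hφ] at hw
        exact mem_iUnion₂.2 ⟨_, hw.1, rfl⟩
      · rintro w f rfl f' hff hw hw'
        obtain ⟨φ, hφM, hφL, hφ⟩ := hβ f
        obtain ⟨ψ, hψM, hψL, hψ⟩ := hβ f'
        have hff' : (β f').1.1 = (β f).1.1 := hff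
        rw [hff'] at hψM hψ
        rw [hH, hφ] at hw
        rw [hH, hψ] at hw'
        have heq := hM _ φ hφM ψ hψM _ hw.1 (hw.2.symm.trans hw'.2)
        refine β.injective (Subtype.ext (Prod.ext hff'.symm ?_))
        rw [hφ, hψ]
        ext t
        constructor
        · rintro ⟨h1, h2⟩
          exact ⟨h1, h2.trans (heq h1)⟩
        · rintro ⟨h1, h2⟩
          exact ⟨h1, h2.trans (heq h1).symm⟩
      · rintro f rfl x hx
        obtain ⟨φ, hφM, hφL, hφ⟩ := hβ f
        obtain ⟨w, hw⟩ := hmk x _ (hφL x hx)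
        rw [ncard_eq_one]
        refine ⟨w, ?_⟩
        ext t
        rw [mem_inter_iff, hH, hφ, hX, mem_singleton_iff]
        constructor
        · rintro ⟨⟨h1, h2⟩, h3⟩
          apply α.injective
          rw [hw]
          rw [h3] at h2
          exact Subtype.ext (Prod.ext h3 h2)
        · rintro rfl
          rw [hw]
          exact ⟨⟨hx, rfl⟩, rfl⟩
  intro hcol
  obtain ⟨T, hT, hind⟩ := hcol _ _ X H hcov (fun x => by
    have h1 : G.degree x = G.degOn univ x := by simp [degOn, degree]
    rw [h1]
    refine (hdeg x (mem_univ x)).trans ?_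
    rw [← Nat.card_eq_finsetCard, ← Nat.card_coe_set_eq]
    refine Nat.card_le_card_of_injective
      (fun a : L x => (⟨α.symm ⟨(x, a), a.2⟩, by simp [hX]⟩ : X x)) fun a b hab => ?_
    have h3 := α.symm.injective (congrArg Subtype.val hab)
    exact Subtype.ext (congrArg (fun q : W => q.1.2) h3))
  have hT' : ∀ x, ∃ w ∈ T, (α w).1.1 = x := fun x => by
    obtain ⟨w, hw⟩ := ncard_eq_one.1 (hT x)
    have : w ∈ T ∩ X x := by rw [hw]; rfl
    exact ⟨w, this.1, this.2⟩
  choose t htT htx using hT'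
  obtain ⟨e, -, φ, hφ, hcφ⟩ := hunc (fun x => (α (t x)).1.2) (fun x _ => by
    have := (α (t x)).2
    rwa [htx] at this)
  have hφL : ∀ x ∈ G.inc e, φ x ∈ L x := fun x hx => by
    have := (α (t x)).2
    rw [htx] at this
    rwa [← hcφ hx]
  obtain ⟨f, hf⟩ := β.surjective ⟨(e, colors e φ), φ, hφ, hφL, rfl⟩
  have hfT : f ∈ (H.induce T).edges := by
    intro w hw
    rw [hH, hf] at hw
    have h2 : t (α w).1.1 = w := by
      apply α.injective
      have h3 := htx (α w).1.1
      have h4 := hw.2.trans (hcφ hw.1).symm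
      exact Subtype.ext (Prod.ext h3 h4.symm)
    rw [← h2]
    exact htT _
  rw [hind] at hfT
  exact hfT

theorem not_isDPDegreeColorable_iff [Finite V] [Finite E] :
    ¬ MultiHypergraph.IsDPDegreeColorable.{u, v, w} G ↔ G.IsBad univ univ :=
  ⟨isBad_of_not_isDPDegreeColorable, not_isDPDegreeColorable_of_isBad⟩

end Conversion

/-! ### Bad covers of DP-hyperbricks -/

section BrickBad

variable {V : Type u} {E : Type v} {G : MultiHypergraph V E}

lemma degOn_multiple_le {n t k : ℕ} (S : SimpleGraph (Fin n)) (x : Fin n)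
    (h : (S.neighborSet x).ncard ≤ k) : (multiple t S).degOn univ x ≤ k * t := by
  have hinj : Injective fun e : S.edgeSet × Fin t => ((e.1 : Sym2 (Fin n)), e.2) := by
    rintro ⟨e, i⟩ ⟨f, j⟩ h
    simp only [Prod.mk.injEq] at h
    exact Prod.ext (Subtype.ext h.1) h.2
  unfold degOn
  rw [← ncard_image_of_injective _ hinj]
  have hsub : (fun e : S.edgeSet × Fin t => ((e.1 : Sym2 (Fin n)), e.2)) ''
      {e | e ∈ univ ∧ x ∈ (multiple t S).inc e} ⊆
      (fun p : Fin n × Fin t => (s(x, p.1), p.2)) '' (S.neighborSet x ×ˢ univ) := by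
    rintro _ ⟨⟨⟨e, he⟩, i⟩, ⟨-, hx⟩, rfl⟩
    have hx' : x ∈ e := hx
    obtain ⟨y, rfl⟩ := hx'
    exact ⟨(y, i), ⟨he, mem_univ _⟩, rfl⟩
  refine (ncard_le_ncard hsub (toFinite _)).trans ((ncard_image_le (toFinite _)).trans ?_)
  rw [ncard_prod, ncard_univ, Nat.card_eq_fintype_card, Fintype.card_fin]
  exact Nat.mul_le_mul_right t h

/-- A DP-coloring of a simple graph with `k` colors, given by permutations along the edges, lifts
to all multiples of the graph. -/
theorem isBad_multiple {n t k : ℕ} (ht : 1 ≤ t) (S : SimpleGraph (Fin n))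
    (π : Fin n → Fin n → Equiv.Perm (Fin k)) (hdeg : ∀ x, (S.neighborSet x).ncard ≤ k)
    (hno : ∀ b : Fin n → Fin k, ∃ x y, x < y ∧ S.Adj x y ∧ b y = π x y (b x)) :
    (multiple t S).IsBad univ univ := by
  have : NeZero t := ⟨by omega⟩
  let ε : Fin k × Fin t ≃ Fin (k * t) := finProdFinEquiv
  -- Colors are pairs in `Fin k × Fin t`. Copy `i` of an edge applies `π` to the first coordinate
  -- and shifts the second by `i`, so the `t` copies together forbid all pairs with matching first
  -- coordinates.
  refine ⟨fun _ => Finset.range (k * t), fun e => {φ | ∃ ψ : Fin n → Fin k × Fin t,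
    (∀ x, φ x = ε (ψ x)) ∧ ∀ x y, x < y → x ∈ (e.1 : Sym2 (Fin n)) → y ∈ (e.1 : Sym2 (Fin n)) →
      (ψ y).1 = π x y (ψ x).1 ∧ (ψ y).2 = (ψ x).2 + e.2}, ?_, ?_, ?_⟩
  · rintro e φ ⟨φ', hφ, hφ'⟩ ψ ⟨ψ', hψ, hψ'⟩ x hx hxx y hy
    rw [hφ, hψ] at hxx ⊢
    have hxx' := ε.injective (Fin.ext hxx)
    congr 2
    rcases lt_trichotomy x y with h | h | h
    · have h1 := hφ' x y h hx hy
      have h2 := hψ' x y h hx hy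
      exact Prod.ext (by rw [h1.1, h2.1, hxx']) (by rw [h1.2, h2.2, hxx'])
    · subst h
      exact hxx'
    · have h1 := hφ' y x h hy hx
      have h2 := hψ' y x h hy hx
      rw [hxx'] at h1
      exact Prod.ext ((π y x).injective (h1.1.symm.trans h2.1))
        (add_right_cancel (h1.2.symm.trans h2.2))
  · intro x _
    rw [Finset.card_range]
    exact degOn_multiple_le S x (hdeg x)
  · intro c hc
    have hc' : ∀ x, c x < k * t := fun x => Finset.mem_range.1 (hc x (mem_univ x))
    let d : Fin n → Fin k × Fin t := fun x => ε.symm ⟨c x, hc' x⟩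
    obtain ⟨x, y, hxy, hadj, hb⟩ := hno fun x => (d x).1
    refine ⟨(⟨s(x, y), hadj⟩, (d y).2 - (d x).2), mem_univ _, c, ⟨d, fun z => by simp [d], ?_⟩,
      fun _ _ => rfl⟩
    intro x' y' hlt hx' hy'
    simp only [Sym2.mem_iff] at hx' hy'
    obtain ⟨rfl, rfl⟩ : x' = x ∧ y' = y := by
      rcases hx' with rfl | rfl <;> rcases hy' with rfl | rfl
      · exact absurd hlt (lt_irrefl _)
      · exact ⟨rfl, rfl⟩
      · exact absurd hlt hxy.asymm
      · exact absurd hlt (lt_irrefl _)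
    exact ⟨hb, by simp⟩

theorem isBad_multiple_completeGraph {n t : ℕ} (ht : 1 ≤ t) (hn : 1 ≤ n) :
    (multiple t (SimpleGraph.completeGraph (Fin n))).IsBad univ univ := by
  refine isBad_multiple (k := n - 1) ht _ (fun _ _ => 1) (fun x => ?_) (fun b => ?_)
  · have hsub : (SimpleGraph.completeGraph (Fin n)).neighborSet x ⊆ {x}ᶜ :=
      fun y hy h => ((SimpleGraph.mem_neighborSet _ _ _).1 hy).ne (mem_singleton_iff.1 h).symm
    refine (ncard_le_ncard hsub (toFinite _)).trans ?_
    rw [ncard_compl, ncard_singleton, Nat.card_eq_fintype_card, Fintype.card_fin]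
  · obtain ⟨x, y, hxy, h⟩ := Fintype.exists_ne_map_eq_of_card_lt b (by simp; omega)
    rcases lt_or_gt_of_ne hxy with hlt | hlt
    · exact ⟨x, y, hlt, by simpa [SimpleGraph.completeGraph] using hxy, by simpa using h.symm⟩
    · exact ⟨y, x, hlt, by simpa [SimpleGraph.completeGraph] using hxy.symm, by simpa using h⟩

theorem isBad_multiple_cycleGraph {n t : ℕ} (ht : 1 ≤ t) (hn : 3 ≤ n) :
    (multiple t (SimpleGraph.cycleGraph n)).IsBad univ univ := by
  refine isBad_multiple (k := 2) ht _
    -- Identities along the path force the two colors to alternate. The closing edge is twisted by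
    -- `n - 1`, the total shift along the path, so that it is violated for either parity of `n`.
    (fun x y => if (x : ℕ) + 1 = y then 1 else Equiv.addRight ((n - 1) • (1 : Fin 2)))
    (fun x => ?_) (fun b => ?_)
  · obtain ⟨n, rfl⟩ : ∃ m, n = m + 3 := ⟨n - 3, by omega⟩
    rw [ncard_eq_toFinset_card']
    exact (SimpleGraph.cycleGraph_degree_three_le (v := x)).le
  · by_contra! hcon
    have htwo : ∀ a d : Fin 2, d ≠ a → d = a + 1 := by decide
    have hstep : ∀ i (hi : i < n), b ⟨i, hi⟩ = b ⟨0, by omega⟩ + i • (1 : Fin 2) := by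
      intro i
      induction i with
      | zero => intro hi; simp
      | succ i ih =>
        intro hi
        have := hcon ⟨i, by omega⟩ ⟨i + 1, hi⟩ (by simp) ((cycleGraph_adj_iff hn _ _).2 (by simp))
        simp only [if_true, Equiv.Perm.coe_one, id_eq] at this
        rw [htwo _ _ this, ih (by omega)]
        rw [succ_nsmul, add_assoc]
    refine hcon ⟨0, by omega⟩ ⟨n - 1, by omega⟩ (by simp; omega)
      ((cycleGraph_adj_iff hn _ _).2 ?_) ?_
    · exact Or.inr (Or.inr (Or.inl ⟨rfl, Nat.sub_add_cancel (by omega)⟩))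
    · rw [if_neg (by simp only; omega), hstep (n - 1) (by omega)]
      rfl

lemma isBad_of_isSingleEdge {e : E} (h : G.IsSingleEdge e) : G.IsBad univ univ := by
  refine ⟨fun _ => {0}, fun _ => {fun _ => 0}, ?_, ?_, ?_⟩
  · rintro e φ rfl ψ rfl x - - y -
    rfl
  · intro x _
    rw [Finset.card_singleton]
    exact (ncard_le_one (((finite_singleton e).subset fun f _ => h.2 f))).2
      fun f _ g _ => (h.2 f).trans (h.2 g).symm
  · intro c hc
    exact ⟨e, mem_univ _, _, rfl, fun x _ => by simpa using hc x (mem_univ x)⟩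

theorem isBad_of_isDPHyperbrick {A : G.Sub} (h : A.coe.IsDPHyperbrick) :
    G.IsBad A.verts A.edges := by
  rcases h with (⟨t, n, ht, hn, ⟨σ⟩⟩ | ⟨t, n, ht, hn, ⟨σ⟩⟩) | ⟨e, he⟩
  · exact (isBad_multiple_completeGraph ht hn).of_iso σ
  · exact (isBad_multiple_cycleGraph ht hn).of_iso σ
  · exact (isBad_of_isSingleEdge he).of_iso ⟨Equiv.refl _, Equiv.refl _, fun e => by simp⟩

end BrickBad

/-! ### Splitting and gluing at a separating vertex -/

section Blocks

variable {V : Type u} {E : Type v} {G : MultiHypergraph V E}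

/-- The subhypergraph of `A` induced by `x` and `Q`. -/
def Sub.side (A : G.Sub) (x : V) (Q : Set V) : G.Sub where
  verts := insert x Q
  edges := {e | e ∈ A.edges ∧ G.inc e ⊆ insert x Q}
  inc_subset _ he := he.2

/-- The vertex `x` separates `Q` and `Q'` in `A`. -/
structure Sub.Separates (A : G.Sub) (x : V) (Q Q' : Set V) : Prop where
  verts_eq : A.verts = insert x (Q ∪ Q')
  notMem_left : x ∉ Q
  notMem_right : x ∉ Q'
  disjoint : Disjoint Q Q'
  left_nonempty : Q.Nonempty
  right_nonempty : Q'.Nonempty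
  subset_or : ∀ e ∈ A.edges, G.inc e ⊆ insert x Q ∨ G.inc e ⊆ insert x Q'

variable {A : G.Sub} {x : V} {Q Q' : Set V}

lemma Sub.Separates.symm (h : A.Separates x Q Q') : A.Separates x Q' Q where
  verts_eq := by rw [h.verts_eq, union_comm]
  notMem_left := h.notMem_right
  notMem_right := h.notMem_left
  disjoint := h.disjoint.symm
  left_nonempty := h.right_nonempty
  right_nonempty := h.left_nonempty
  subset_or e he := (h.subset_or e he).symm

lemma Sub.Separates.subset_left (h : A.Separates x Q Q') {e : E} (he : e ∈ A.edges) {y : V}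
    (hy : y ∈ Q) (hye : y ∈ G.inc e) : G.inc e ⊆ insert x Q := by
  refine (h.subset_or e he).resolve_right fun h' => ?_
  rcases h' hye with rfl | hy'
  · exact h.notMem_left hy
  · exact h.disjoint.notMem_of_mem_left hy hy'

lemma exists_separates {A : G.Sub} (h : ¬ G.NonsepOn A.verts A.edges) :
    ∃ x Q Q', A.Separates x Q Q' := by
  unfold NonsepOn ConnOn at h
  push Not at h
  obtain ⟨x, hx, Q, hQ, hne, hne', hQe⟩ := h
  refine ⟨x, Q, (A.verts \ {x}) \ Q, ?_, fun h => (hQ h).2 rfl, fun h => h.1.2 rfl,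
    disjoint_sdiff_right, hne, hne', fun e he => ?_⟩
  · rw [union_sdiff_cancel hQ, insert_sdiff_singleton, insert_eq_of_mem hx]
  · by_cases hemp : (G.inc e ∩ Q).Nonempty
    · left
      intro y hy
      by_contra hyQ
      simp only [mem_insert_iff, not_or] at hyQ
      have : y ∈ G.inc e ∩ ((A.verts \ {x}) \ Q) := ⟨hy, ⟨A.inc_subset e he hy, hyQ.1⟩, hyQ.2⟩
      rw [hQe e he hemp] at this
      exact this
    · right
      intro y hy
      by_cases hyx : y = x
      · exact Or.inl hyx
      · exact Or.inr ⟨⟨A.inc_subset e he hy, hyx⟩, fun h => hemp ⟨y, hy, h⟩⟩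

lemma Sub.Separates.side_le (h : A.Separates x Q Q') : A.side x Q ≤ A :=
  ⟨by rw [h.verts_eq]; exact insert_subset_insert subset_union_left, fun _ he => he.1⟩

lemma Sub.Separates.connOn_side (h : A.Separates x Q Q') (hA : G.ConnOn A.verts A.edges) :
    G.ConnOn (A.side x Q).verts (A.side x Q).edges := by
  have key : ∀ P ⊆ Q, P.Nonempty → ∃ e ∈ (A.side x Q).edges,
      (G.inc e ∩ P).Nonempty ∧ (G.inc e ∩ (insert x Q \ P)).Nonempty := by
    intro P hP hne
    obtain ⟨e, he, ⟨y, hye, hy⟩, ⟨z, hze, hz⟩⟩ := hA P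
      ((hP.trans (subset_insert x Q)).trans h.side_le.1) hne
      ⟨x, by rw [h.verts_eq]; exact mem_insert _ _, fun hx => h.notMem_left (hP hx)⟩
    have hsub := h.subset_left he (hP hy) hye
    exact ⟨e, ⟨he, hsub⟩, ⟨y, hye, hy⟩, ⟨z, hze, hsub hze, hz.2⟩⟩
  intro P hP hne hne'
  change P ⊆ insert x Q at hP
  change (insert x Q \ P).Nonempty at hne'
  by_cases hx : x ∈ P
  · obtain ⟨e, he, h1, h2⟩ := key (insert x Q \ P) (fun y hy =>
      (mem_insert_iff.1 hy.1).resolve_left (by rintro rfl; exact hy.2 hx)) hne'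
    rw [sdiff_sdiff_cancel_left hP] at h2
    exact ⟨e, he, h2, h1⟩
  · exact key P (fun y hy => (mem_insert_iff.1 (hP hy)).resolve_left
      (by rintro rfl; exact hx hy)) hne

lemma Sub.Separates.disjoint_edges (h : A.Separates x Q Q') :
    Disjoint (A.side x Q).edges (A.side x Q').edges := by
  rw [disjoint_left]
  rintro e ⟨-, he⟩ ⟨-, he'⟩
  obtain ⟨y, hy, hyx⟩ := (G.inc_nontrivial e).exists_ne x
  exact h.disjoint.notMem_of_mem_left ((mem_insert_iff.1 (he hy)).resolve_left hyx)
    ((mem_insert_iff.1 (he' hy)).resolve_left hyx)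

lemma Sub.Separates.degOn_eq [Finite E] (h : A.Separates x Q Q') (y : V) :
    G.degOn A.edges y = G.degOn (A.side x Q).edges y + G.degOn (A.side x Q').edges y := by
  unfold degOn
  rw [← ncard_union_eq (h.disjoint_edges.mono (fun _ h => h.1) (fun _ h => h.1)) (toFinite _)
    (toFinite _)]
  congr 1
  ext e
  simp only [mem_ofPred_eq, mem_union, Sub.side]
  constructor
  · rintro ⟨he, hy⟩
    rcases h.subset_or e he with h' | h'
    · exact Or.inl ⟨⟨he, h'⟩, hy⟩
    · exact Or.inr ⟨⟨he, h'⟩, hy⟩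
  · rintro (⟨⟨he, -⟩, hy⟩ | ⟨⟨he, -⟩, hy⟩) <;> exact ⟨he, hy⟩

lemma Sub.Separates.degOn_left [Finite E] (h : A.Separates x Q Q') {y : V} (hy : y ∈ Q) :
    G.degOn A.edges y = G.degOn (A.side x Q).edges y := by
  rw [h.degOn_eq, Nat.add_eq_left]
  unfold degOn
  rw [ncard_eq_zero (toFinite _), eq_empty_iff_forall_notMem]
  rintro e ⟨⟨-, he⟩, hye⟩
  rcases he hye with rfl | hy'
  · exact h.notMem_left hy
  · exact h.disjoint.notMem_of_mem_left hy hy'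

open Classical in
/-- The colors at `x` that do not extend to `Q`. -/
noncomputable def Sub.badColors (A : G.Sub) (x : V) (Q : Set V) (L : V → Finset ℕ)
    (M : E → Set (V → ℕ)) : Finset ℕ :=
  (L x).filter fun a => ¬ ∃ c : V → ℕ, c x = a ∧ (∀ y ∈ Q, c y ∈ L y) ∧
    ∀ e ∈ (A.side x Q).edges, ¬ G.Violates M c e

lemma Sub.uncolorable_badColors [DecidableEq V] (A : G.Sub) {x : V} {Q : Set V} (hx : x ∉ Q)
    (L : V → Finset ℕ) (M : E → Set (V → ℕ)) :
    G.Uncolorable (A.side x Q).verts (A.side x Q).edges (update L x (A.badColors x Q L M)) M := by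
  intro c hc
  have hcx := hc x (mem_insert x Q)
  simp only [update_self, Sub.badColors, Finset.mem_filter] at hcx
  by_contra! hcon
  refine hcx.2 ⟨c, rfl, fun y hy => ?_, hcon⟩
  have := hc y (mem_insert_of_mem x hy)
  rwa [update_of_ne (by rintro rfl; exact hx hy)] at this

/-- With its list at `x` cut down to the failing colors, the side is uncolorable and connected, so
`x` cannot have more colors than its degree there. -/
lemma Sub.Separates.card_badColors_le [Finite V] [Finite E] (h : A.Separates x Q Q')
    (hA : G.ConnOn A.verts A.edges) {L : V → Finset ℕ} {M : E → Set (V → ℕ)} (hM : G.IsMatched M)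
    (hdeg : ∀ y ∈ A.verts, G.degOn A.edges y ≤ (L y).card) :
    (A.badColors x Q L M).card ≤ G.degOn (A.side x Q).edges x := by
  classical
  by_contra! hlt
  have := (h.connOn_side hA).card_le (L := update L x (A.badColors x Q L M)) hM
    (fun y hy => by
      by_cases hyx : y = x
      · subst hyx; simpa using hlt.le
      · rw [update_of_ne hyx]
        exact (degOn_mono h.side_le.2 y).trans (hdeg y (h.side_le.1 hy)))
    (fun e he => by
      obtain ⟨y, hy⟩ := (G.inc_nontrivial e).nonempty
      exact ⟨y, hy, he.2 hy⟩)
    (A.uncolorable_badColors h.notMem_left L M) (mem_insert x Q)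
  rw [update_self] at this
  omega

theorem Sub.Separates.isBad_side [Finite V] [Finite E] (h : A.Separates x Q Q')
    (hA : G.ConnOn A.verts A.edges) (hbad : G.IsBad A.verts A.edges) :
    G.IsBad (A.side x Q).verts (A.side x Q).edges := by
  classical
  obtain ⟨L, M, hM, hdeg, hunc⟩ := hbad
  have hxA : x ∈ A.verts := h.side_le.1 (mem_insert x Q)
  have hcover : L x ⊆ A.badColors x Q L M ∪ A.badColors x Q' L M := by
    intro a ha
    by_contra hcon
    simp only [Finset.mem_union, not_or, Sub.badColors, Finset.mem_filter, ha, true_and,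
      not_not] at hcon
    obtain ⟨⟨c₁, h1x, h1L, h1e⟩, ⟨c₂, h2x, h2L, h2e⟩⟩ := hcon
    have heq₁ : EqOn (fun y => if y ∈ Q then c₁ y else c₂ y) c₁ (insert x Q) := by
      rintro y (rfl | hy)
      · simp [h.notMem_left, h1x, h2x]
      · simp [hy]
    have heq₂ : EqOn (fun y => if y ∈ Q then c₁ y else c₂ y) c₂ (insert x Q') := by
      rintro y (rfl | hy)
      · simp [h.notMem_left]
      · simp [h.disjoint.notMem_of_mem_right hy]
    obtain ⟨e, he, hv⟩ := hunc (fun y => if y ∈ Q then c₁ y else c₂ y) (fun y hy => by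
      rw [h.verts_eq] at hy
      rcases hy with rfl | hy | hy
      · simpa [h.notMem_left, h2x] using ha
      · simpa [hy] using h1L y hy
      · simpa [h.disjoint.notMem_of_mem_right hy] using h2L y hy)
    rcases h.subset_or e he with hsub | hsub
    · exact h1e e ⟨he, hsub⟩ (hv.congr (heq₁.mono hsub))
    · exact h2e e ⟨he, hsub⟩ (hv.congr (heq₂.mono hsub))
  refine ⟨update L x (A.badColors x Q L M), M, hM, fun y hy => ?_,
    A.uncolorable_badColors h.notMem_left L M⟩
  by_cases hyx : y = x
  · subst hyx
    rw [update_self]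
    -- The degrees of `x` in the two sides add up to its degree in `A`, and the other side accounts
    -- for at most its own share of failing colors.
    have h1 := (Finset.card_le_card hcover).trans (Finset.card_union_le _ _)
    have h2 := h.symm.card_badColors_le hA hM hdeg
    have h3 := hdeg y hxA
    have h4 := h.degOn_eq y
    omega
  · rw [update_of_ne hyx]
    exact (degOn_mono h.side_le.2 y).trans (hdeg y (h.side_le.1 hy))

theorem Sub.Separates.isBad [Finite E] (h : A.Separates x Q Q')
    (h₁ : G.IsBad (A.side x Q).verts (A.side x Q).edges)
    (h₂ : G.IsBad (A.side x Q').verts (A.side x Q').edges) : G.IsBad A.verts A.edges := by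
  classical
  obtain ⟨L₁, M₁, hM₁, hdeg₁, hunc₁⟩ := h₁
  obtain ⟨L₂, M₂, hM₂, hdeg₂, hunc₂⟩ := h₂
  -- Even colors serve one side and odd colors the other. The parity of the color at `x` decides
  -- which side fails.
  let α : ℕ → ℕ := fun a => 2 * a
  let β : ℕ → ℕ := fun a => 2 * a + 1
  have hα : Injective α := fun a b h => by simp only [α] at h; omega
  have hβ : Injective β := fun a b h => by simp only [β] at h; omega
  let L : V → Finset ℕ := fun y => if y = x then (L₁ x).image α ∪ (L₂ x).image β
    else if y ∈ Q then (L₁ y).image α else (L₂ y).image β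
  let M : E → Set (V → ℕ) := fun e => if G.inc e ⊆ insert x Q then {φ | ∃ ψ ∈ M₁ e, φ = α ∘ ψ}
    else {φ | ∃ ψ ∈ M₂ e, φ = β ∘ ψ}
  have hLx : L x = (L₁ x).image α ∪ (L₂ x).image β := by simp [L]
  have hLQ : ∀ y ∈ Q, L y = (L₁ y).image α := fun y hy => by
    have : y ≠ x := by rintro rfl; exact h.notMem_left hy
    simp [L, this, hy]
  have hLQ' : ∀ y ∈ Q', L y = (L₂ y).image β := fun y hy => by
    have : y ≠ x := by rintro rfl; exact h.notMem_right hy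
    simp [L, this, h.disjoint.notMem_of_mem_right hy]
  have hMQ : ∀ e ∈ (A.side x Q).edges, M e = {φ | ∃ ψ ∈ M₁ e, φ = α ∘ ψ} := fun e he =>
    if_pos he.2
  have hMQ' : ∀ e ∈ (A.side x Q').edges, M e = {φ | ∃ ψ ∈ M₂ e, φ = β ∘ ψ} := fun e he =>
    if_neg fun h' => h.disjoint_edges.notMem_of_mem_right he ⟨he.1, h'⟩
  refine ⟨L, M, ?_, ?_, ?_⟩
  · intro e φ hφ ψ hψ y hy hyy z hz
    by_cases hsub : G.inc e ⊆ insert x Q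
    · simp only [M, if_pos hsub] at hφ hψ
      obtain ⟨φ, hφ, rfl⟩ := hφ
      obtain ⟨ψ, hψ, rfl⟩ := hψ
      exact congrArg α (hM₁ e φ hφ ψ hψ y hy (hα hyy) hz)
    · simp only [M, if_neg hsub] at hφ hψ
      obtain ⟨φ, hφ, rfl⟩ := hφ
      obtain ⟨ψ, hψ, rfl⟩ := hψ
      exact congrArg β (hM₂ e φ hφ ψ hψ y hy (hβ hyy) hz)
  · intro y hy
    rw [h.verts_eq] at hy
    rcases hy with rfl | hy | hy
    · rw [hLx, Finset.card_union_of_disjoint, Finset.card_image_of_injective _ hα,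
        Finset.card_image_of_injective _ hβ, h.degOn_eq]
      · exact add_le_add (hdeg₁ y (mem_insert _ _)) (hdeg₂ y (mem_insert _ _))
      · rw [Finset.disjoint_left]
        intro a ha hb
        obtain ⟨a, -, rfl⟩ := Finset.mem_image.1 ha
        obtain ⟨b, -, hab⟩ := Finset.mem_image.1 hb
        simp only [α, β] at hab
        omega
    · rw [hLQ y hy, Finset.card_image_of_injective _ hα, h.degOn_left hy]
      exact hdeg₁ y (mem_insert_of_mem x hy)
    · rw [hLQ' y hy, Finset.card_image_of_injective _ hβ, h.symm.degOn_left hy]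
      exact hdeg₂ y (mem_insert_of_mem x hy)
  · intro c hc
    have hcx := hc x (by rw [h.verts_eq]; exact mem_insert _ _)
    rw [hLx, Finset.mem_union] at hcx
    rcases hcx with hcx | hcx
    · have hc' : ∀ y ∈ insert x Q, ∃ a ∈ L₁ y, α a = c y := by
        rintro y (rfl | hy)
        · exact Finset.mem_image.1 hcx
        · have := hc y (h.side_le.1 (mem_insert_of_mem x hy))
          rw [hLQ y hy] at this
          exact Finset.mem_image.1 this
      choose! d hd hdc using hc'
      obtain ⟨e, he, φ, hφ, hdφ⟩ := hunc₁ d hd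
      refine ⟨e, he.1, α ∘ φ, ?_, fun y hy => ?_⟩
      · rw [hMQ e he]
        exact ⟨φ, hφ, rfl⟩
      · rw [← hdc y (he.2 hy), hdφ hy]
        rfl
    · have hc' : ∀ y ∈ insert x Q', ∃ a ∈ L₂ y, β a = c y := by
        rintro y (rfl | hy)
        · exact Finset.mem_image.1 hcx
        · have := hc y (h.symm.side_le.1 (mem_insert_of_mem x hy))
          rw [hLQ' y hy] at this
          exact Finset.mem_image.1 this
      choose! d hd hdc using hc'
      obtain ⟨e, he, φ, hφ, hdφ⟩ := hunc₂ d hd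
      refine ⟨e, he.1, β ∘ φ, ?_, fun y hy => ?_⟩
      · rw [hMQ' e he]
        exact ⟨φ, hφ, rfl⟩
      · rw [← hdc y (he.2 hy), hdφ hy]
        rfl

/-- `B` is a block of the subhypergraph `A`. -/
def Sub.IsBlockOf (B A : G.Sub) : Prop :=
  Maximal (fun C : G.Sub => C ≤ A ∧ G.ConnOn C.verts C.edges ∧ G.NonsepOn C.verts C.edges) B

lemma Sub.le_trans' {A B C : G.Sub} (h : A ≤ B) (h' : B ≤ C) : A ≤ C :=
  ⟨h.1.trans h'.1, h.2.trans h'.2⟩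

lemma Sub.le_antisymm' : ∀ {A B : G.Sub}, A ≤ B → B ≤ A → A = B
  | ⟨_, _, _⟩, ⟨_, _, _⟩, h, h' => by
    obtain rfl := h.1.antisymm h'.1
    obtain rfl := h.2.antisymm h'.2
    rfl

/-- If `C` had vertices in both `Q` and `Q'`, deleting `x` would disconnect it. -/
lemma Sub.Separates.le_side_or (h : A.Separates x Q Q') {C : G.Sub} (hC : C ≤ A)
    (hconn : G.ConnOn C.verts C.edges) (hsep : G.NonsepOn C.verts C.edges) :
    C ≤ A.side x Q ∨ C ≤ A.side x Q' := by
  have hverts : C.verts ⊆ insert x Q ∨ C.verts ⊆ insert x Q' := by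
    by_contra! hcon
    obtain ⟨⟨y, hy, hyQ⟩, ⟨z, hz, hzQ⟩⟩ := hcon.imp not_subset.1 not_subset.1
    simp only [mem_insert_iff, not_or] at hyQ hzQ
    have hmem : ∀ t ∈ C.verts, t = x ∨ t ∈ Q ∨ t ∈ Q' := fun t ht => by
      have := hC.1 ht
      rwa [h.verts_eq] at this
    have hyQ' : y ∈ Q' := ((hmem y hy).resolve_left hyQ.1).resolve_left hyQ.2
    have hzQ' : z ∈ Q := ((hmem z hz).resolve_left hzQ.1).resolve_right hzQ.2
    have hconn' : G.ConnOn (C.verts \ {x}) C.edges := by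
      by_cases hx : x ∈ C.verts
      · exact hsep x hx
      · rwa [sdiff_singleton_eq_self hx]
    obtain ⟨e, he, ⟨t, hte, ht⟩, ⟨s, hse, hs⟩⟩ := hconn' (C.verts ∩ Q)
      (fun t ht => ⟨ht.1, by rintro rfl; exact h.notMem_left ht.2⟩) ⟨z, hz, hzQ'⟩
      ⟨y, ⟨hy, hyQ.1⟩, fun h => hyQ.2 h.2⟩
    rcases h.subset_left (hC.2 he) ht.2 hte hse with rfl | hsQ
    · exact hs.1.2 rfl
    · exact hs.2 ⟨hs.1.1, hsQ⟩
  exact hverts.imp (fun h' => ⟨h', fun e he => ⟨hC.2 he, (C.inc_subset e he).trans h'⟩⟩)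
    (fun h' => ⟨h', fun e he => ⟨hC.2 he, (C.inc_subset e he).trans h'⟩⟩)

/-- A larger competitor inside the other side would force `B` to be the single vertex `x`. But some
edge of the side contains `x`, and the subhypergraph consisting of that edge is a larger candidate.
-/
lemma Sub.Separates.isBlockOf (h : A.Separates x Q Q') (hA : G.ConnOn A.verts A.edges) {B : G.Sub}
    (hB : B.IsBlockOf (A.side x Q)) : B.IsBlockOf A := by
  refine ⟨⟨Sub.le_trans' hB.prop.1 h.side_le, hB.prop.2⟩, fun C hC hBC => ?_⟩
  rcases h.le_side_or hC.1 hC.2.1 hC.2.2 with hC' | hC'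
  · exact hB.2 ⟨hC', hC.2⟩ hBC
  · exfalso
    have hBx : B.verts ⊆ {x} := by
      intro y hy
      rcases hB.prop.1.1 hy with rfl | hyQ
      · rfl
      · rcases hC'.1 (hBC.1 hy) with rfl | hyQ'
        · rfl
        · exact absurd hyQ' (h.disjoint.notMem_of_mem_left hyQ)
    obtain ⟨y, hy⟩ := h.left_nonempty
    obtain ⟨e, he, ⟨z, hze, hz⟩, -⟩ := h.connOn_side hA {x}
      (singleton_subset_iff.2 (mem_insert x Q)) (singleton_nonempty x)
      ⟨y, mem_insert_of_mem x hy, by rintro rfl; exact h.notMem_left hy⟩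
    obtain rfl := mem_singleton_iff.1 hz
    let D : G.Sub := ⟨G.inc e, {e}, fun f hf => by rw [mem_singleton_iff.1 hf]⟩
    have hD : ∀ R ⊆ G.inc e, G.ConnOn R {e} := fun R hR P hP ⟨s, hs⟩ ⟨t, ht⟩ =>
      ⟨e, rfl, ⟨s, hR (hP hs), hs⟩, ⟨t, hR ht.1, ht⟩⟩
    have hBD : B ≤ D := by
      refine ⟨fun s hs => by rw [mem_singleton_iff.1 (hBx hs)]; exact hze, fun f hf => ?_⟩
      obtain ⟨s, hs, hsz⟩ := (G.inc_nontrivial f).exists_ne z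
      exact absurd (hBx (B.inc_subset f hf hs)) hsz
    have hDB : D ≤ B := hB.2 ⟨⟨he.2, singleton_subset_iff.2 he⟩, hD _ subset_rfl,
      fun t _ => hD _ sdiff_subset⟩ hBD
    obtain ⟨s, hs, hsz⟩ := (G.inc_nontrivial e).exists_ne z
    exact hsz (hBx (hDB.1 hs))

lemma Sub.Separates.isBlockOf_iff (h : A.Separates x Q Q') (hA : G.ConnOn A.verts A.edges)
    {B : G.Sub} : B.IsBlockOf A ↔ B.IsBlockOf (A.side x Q) ∨ B.IsBlockOf (A.side x Q') := by
  constructor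
  · intro hB
    exact (h.le_side_or hB.prop.1 hB.prop.2.1 hB.prop.2.2).imp
      (fun h' => ⟨⟨h', hB.prop.2⟩, fun C hC => hB.2 ⟨Sub.le_trans' hC.1 h.side_le, hC.2⟩⟩)
      (fun h' => ⟨⟨h', hB.prop.2⟩, fun C hC => hB.2 ⟨Sub.le_trans' hC.1 h.symm.side_le, hC.2⟩⟩)
  · rintro (hB | hB)
    · exact h.isBlockOf hA hB
    · exact h.symm.isBlockOf hA hB

lemma Sub.isBlockOf_iff_eq {A B : G.Sub} (hA : G.ConnOn A.verts A.edges)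
    (hsep : G.NonsepOn A.verts A.edges) : B.IsBlockOf A ↔ B = A := by
  constructor
  · intro hB
    exact Sub.le_antisymm' hB.prop.1 (hB.2 ⟨⟨subset_rfl, subset_rfl⟩, hA, hsep⟩ hB.prop.1)
  · rintro rfl
    exact ⟨⟨⟨subset_rfl, subset_rfl⟩, hA, hsep⟩, fun C hC _ => hC.1⟩

theorem isBad_iff_forall_isBlockOf [Finite V] [Finite E] (A : G.Sub) (hne : A.verts.Nonempty)
    (hA : G.ConnOn A.verts A.edges) :
    G.IsBad A.verts A.edges ↔ ∀ B : G.Sub, B.IsBlockOf A → B.coe.IsDPHyperbrick := by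
  induction hn : A.verts.ncard using Nat.strong_induction_on generalizing A with
  | _ n ih =>
    by_cases hsep : G.NonsepOn A.verts A.edges
    · simp only [Sub.isBlockOf_iff_eq hA hsep, forall_eq]
      refine ⟨fun hbad => ?_, isBad_of_isDPHyperbrick⟩
      have : Nonempty A.verts := hne.to_subtype
      refine isDPHyperbrick_of_isBad ?_ (fun x => ?_) hbad.coe
      · rwa [Sub.connOn_coe_iff, Sub.image_univ]
      · rw [Sub.connOn_coe_iff, Sub.image_compl]
        exact hsep x x.2
    · obtain ⟨x, Q, Q', h⟩ := exists_separates hsep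
      have hlt : ∀ {Q Q'}, A.Separates x Q Q' → (A.side x Q).verts.ncard < n := by
        intro Q Q' h
        obtain ⟨y, hy⟩ := h.right_nonempty
        rw [← hn]
        refine ncard_lt_ncard ⟨h.side_le.1, fun hs => ?_⟩ (toFinite _)
        rcases hs (h.symm.side_le.1 (mem_insert_of_mem x hy)) with rfl | hyQ
        · exact h.notMem_right hy
        · exact h.disjoint.notMem_of_mem_left hyQ hy
      have h1 := ih _ (hlt h) (A.side x Q) ⟨x, mem_insert _ _⟩ (h.connOn_side hA) rfl
      have h2 := ih _ (hlt h.symm) (A.side x Q') ⟨x, mem_insert _ _⟩ (h.symm.connOn_side hA) rfl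
      simp only [h.isBlockOf_iff hA, or_imp, forall_and]
      rw [← h1, ← h2]
      exact ⟨fun hb => ⟨h.isBad_side hA hb, h.symm.isBad_side hA hb⟩, fun hb => h.isBad hb.1 hb.2⟩

end Blocks

end MultiHypergraph

open MultiHypergraph in
theorem mainTheorem3 {V : Type u} {E : Type v} [Finite V] [Finite E]
    (G : MultiHypergraph V E) (hG : G.IsConnected) :
    ¬ MultiHypergraph.IsDPDegreeColorable.{u, v, w} G ↔
      ∀ B : G.Sub, G.IsBlock B → B.coe.IsDPHyperbrick := by
  let T : G.Sub := ⟨Set.univ, Set.univ, fun _ _ => Set.subset_univ _⟩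
  have hT : ∀ B : G.Sub, B.IsBlockOf T ↔ G.IsBlock B := by
    intro B
    have hle : ∀ C : G.Sub, C ≤ T := fun C => ⟨Set.subset_univ _, Set.subset_univ _⟩
    unfold IsBlock Sub.IsBlockOf
    simp only [hle, true_and, Sub.isConnected_coe_iff, Sub.not_isSeparating_coe_iff]
  rw [isConnected_iff] at hG
  rw [not_isDPDegreeColorable_iff]
  simp only [← hT]
  -- On no vertices both sides of the equivalence are false: the empty coloring violates nothing,
  -- while the empty hypergraph is its own block and not a DP-hyperbrick.
  rcases isEmpty_or_nonempty V with hV | hV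
  · have hE : IsEmpty E := ⟨fun e => hV.elim (G.inc_nontrivial e).nonempty.some⟩
    constructor
    · rintro ⟨L, M, -, -, hunc⟩
      obtain ⟨e, -⟩ := hunc (fun _ => 0) (fun x => hV.elim x)
      exact hE.elim e
    · intro h
      rcases h T ((Sub.isBlockOf_iff_eq hG (fun x => hV.elim x)).2 rfl) with
        (⟨t, n, -, hn, ⟨σ⟩⟩ | ⟨t, n, -, hn, ⟨σ⟩⟩) | ⟨e, -⟩
      · exact hV.elim (σ.vertEquiv.symm ⟨0, by omega⟩ : T.verts)
      · exact hV.elim (σ.vertEquiv.symm ⟨0, by omega⟩ : T.verts)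
      · exact hE.elim (e : E)
  · exact isBad_iff_forall_isBlockOf T Set.univ_nonempty hG
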